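/- **Conventions.** Rings are commutative with unit. Let $I$ be a finite set, $n_I=(n_i)_{i\in I}\in\mathbb N^I$; for each $i\in I$ let $X_i$ and $X_i^*$ be tuples of $n_i+1$ indeterminates, and write $X^*_S=(X^*_i)_{i\in S}$ for $S\subseteq I$. *Splittable forms.* For $n,D\in\mathbb N$ and copies $X_t$ ($t<D$) of $X=(X_0,\dots,X_n)$, put $G_D(X^*)=\prod_{t<D}(X^*\cdot X_t)=\sum_{|\alpha|=D}\sigma_\alpha {X^*}^{\alpha}$, with $\sigma_\alpha\in\mathbb Z[X_t:t<D]$, and $\sigma_D=(\sigma_\alpha)_{|\alpha|=D}$. A form $g=\sum_{|\alpha|=D}a_\alpha {X^*}^\alpha$ of degree $D>0$ over a ring $A$ is *splittable* if $(a_\alpha)_\alpha$ satisfies every polynomial relation over $\mathbb Z$ satisfied by $\sigma_D$. Every form of degree $D=0$ is splittable. *Wedge.* Let $F=\sum_{|\alpha|=d}T^*_\alpha X^\alpha$ be the indeterminate form of degree $d$, let $F\wedge G_D=\prod_{t<D}F(X_t)$, and let $Y$ be a further indeterminate. Let $A$ be a reduced ring, $f\in A[X]$ a form of degree $d$ and $g\in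 A[X^*]$ a splittable form of degree $D$. If there is a ring morphism $\varphi\colon\mathbb Z[T^*,Y,\sigma_D,F\wedge G_D]\to A$ sending $F\mapsto f$ and $YG_D\mapsto g$, then $f\wedge g=\varphi(Y)^d\varphi(F\wedge G_D)\in A$; this does not depend on $\varphi$, and equals $y^d\prod_{t<D} f(x_t)$ when $g=y\prod_{t<D}(X^*\cdot x_t)$ over $A$. If there is no such $\varphi$, put $f\wedge g=0$ (such a $\varphi$ always exists if $A$ is an integrally closed domain). If $R\in A[X^*_I]$ is splittable as a form in $X^*_i$ and $f\in A[X_i]$ is a form, then $f\wedge_i R\in A[X^*_{I\setminus\{i\}}]$ denotes the wedge of $f$ with $R$, viewed as a form in $X_i^*$ over $A[X^*_{I\setminus\{i\}}]$. *Resultants.* Recursively on $|I|$: a polynomial $R\in A[X^*_I]$, homogeneous of a given degree $D_i$ in each $X_i^*$, is a *resultant* in $X^*_I$ over $A$ if for every $i\in I$: (1) $R$ is splittable as a form in $X^*_i$; (2) for every reduced $A$-algebra $B$ and every form $f\in B[X_i]$ of any degree $d$, $f\wedge_i R$ is a resultant in $X^*_{I\setminus\{i\}}$ over $B$ (of degrees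 $dD_j$); (3) moreover, for every $j\in I\setminus\{i\}$ and every form $g\in B[X_j]$, $g\wedge_j f\wedge_i R=f\wedge_i g\wedge_j R$. **Corollary.** Let $i\in I$ and $J=I\setminus\{i\}$. Let $A$ be a unique factorisation domain and let $R\in A[X^*_I]\setminus A[X^*_J]$ be an irreducible resultant over $A$. Let $d\ge 1$ and let $F_i=\sum_{|\alpha|=d}T^*_{i,\alpha}X_i^\alpha$ be an indeterminate form of degree $d$ in $X_i$, where $T^*_i=(T^*_{i,\alpha})_{|\alpha|=d}$. Then $F_i\wedge_i R\in A[T^*_i,X^*_J]$ is irreducible. -/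

import Mathlib

open MvPolynomial

noncomputable section

namespace ResultantWedge

universe u v

/-- The multi-exponents `α ∈ ℕ^(n+1)` with `|α| = d`. -/
abbrev Expo (n d : ℕ) : Type :=
  {α : Fin (n + 1) →₀ ℕ // α ∈ (Finset.univ : Finset (Fin (n + 1))).finsuppAntidiag d}

/-- The indeterminate form `F = ∑_{|α| = d} T_α X^α` of degree `d` in `n + 1` variables, with
coefficients in `A[T]`, `T = (T_α : |α| = d)`. -/
def indetForm (A : Type u) [CommRing A] (n d : ℕ) :
    MvPolynomial (Fin (n + 1)) (MvPolynomial (Expo n d) A) :=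
  ∑ α : Expo n d, monomial α.1 (X α)

/-- `G_D(X*) = ∏_{t < D} (X* · X_t)`, with coefficients in `ℤ[X_t : t < D]`; the variable `(t, j)`
is the `j`-th coordinate of `X_t`. -/
def genericProduct (n D : ℕ) :
    MvPolynomial (Fin (n + 1)) (MvPolynomial (Fin D × Fin (n + 1)) ℤ) :=
  ∏ t : Fin D, ∑ j : Fin (n + 1), C (X (t, j)) * X j

/-- The elementary homogeneous symmetric polynomials `σ_α`, `|α| = D`: the coefficients
of `G_D`. -/
def elemSymm (n D : ℕ) (α : Expo n D) : MvPolynomial (Fin D × Fin (n + 1)) ℤ :=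
  coeff α.1 (genericProduct n D)

/-- `g` is splittable as a form of degree `D`: its coefficients satisfy every polynomial relation
over `ℤ` that the `σ_α` satisfy. Every form of degree `0` is splittable. -/
def IsSplittable {A : Type u} [CommRing A] {n : ℕ} (D : ℕ) (g : MvPolynomial (Fin (n + 1)) A) :
    Prop :=
  g.IsHomogeneous D ∧
    (0 < D → ∀ P : MvPolynomial (Expo n D) ℤ,
      aeval (elemSymm n D) P = 0 → aeval (fun α : Expo n D => coeff α.1 g) P = 0)

/-- Names of the indeterminates `T_α`, `Y` and `X_{t,j}` of the universal wedge. -/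
inductive UVar (n d D : ℕ) : Type
  | T (α : Expo n d) : UVar n d D
  | Y : UVar n d D
  | pt (t : Fin D) (j : Fin (n + 1)) : UVar n d D

/-- The universal wedge `F ∧ G_D = ∏_{t < D} F(X_t)`. -/
def univWedge (n d D : ℕ) : MvPolynomial (UVar n d D) ℤ :=
  ∏ t : Fin D, ∑ α : Expo n d, X (UVar.T α) * ∏ j : Fin (n + 1), X (UVar.pt t j) ^ α.1 j

/-- `σ_α` as a polynomial in the variables `UVar n d D`. -/
def univSymm (n d D : ℕ) (α : Expo n D) : MvPolynomial (UVar n d D) ℤ :=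
  rename (fun v : Fin D × Fin (n + 1) => UVar.pt v.1 v.2) (elemSymm n D α)

/-- The ring `ℤ[T, Y, σ_D, F ∧ G_D]`. The generator `F ∧ G_D` has to be listed: it is symmetric in
the `X_t`, but in general it is not a polynomial in `T` and the `σ_α` with integer coefficients
(for instance for `n = 3`, `D = 2`, `d = 3`). -/
def wedgeRing (n d D : ℕ) : Subalgebra ℤ (MvPolynomial (UVar n d D) ℤ) :=
  Algebra.adjoin ℤ
    (Set.range (fun α : Expo n d => X (UVar.T α)) ∪ {X UVar.Y} ∪ Set.range (univSymm n d D) ∪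
      {univWedge n d D})

/-- `T_α` as an element of `wedgeRing`. -/
def genT (n d D : ℕ) (α : Expo n d) : wedgeRing n d D :=
  ⟨X (UVar.T α), Algebra.subset_adjoin (Or.inl (Or.inl (Or.inl ⟨α, rfl⟩)))⟩

/-- `Y` as an element of `wedgeRing`. -/
def genY (n d D : ℕ) : wedgeRing n d D :=
  ⟨X UVar.Y, Algebra.subset_adjoin (Or.inl (Or.inl (Or.inr rfl)))⟩

/-- `σ_α` as an element of `wedgeRing`. -/
def genS (n d D : ℕ) (α : Expo n D) : wedgeRing n d D :=
  ⟨univSymm n d D α, Algebra.subset_adjoin (Or.inl (Or.inr ⟨α, rfl⟩))⟩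

/-- `F ∧ G_D` as an element of `wedgeRing`. -/
def genW (n d D : ℕ) : wedgeRing n d D :=
  ⟨univWedge n d D, Algebra.subset_adjoin (Or.inr rfl)⟩

/-- `w` is a value of `f ∧ g`, where `f` has degree `d` and `g` has degree `D`: there is a ring
morphism `φ` sending `F` to `f` and `Y G_D` to `g`, and `w = φ(Y)^d φ(F ∧ G_D)`.
If `A` is reduced, there is at most one such `w`. If `g = y ∏ (X* · x_t)` over `A`, then
`y ^ d ∏ f(x_t)` is such a `w`. -/
def IsWedge {A : Type u} [CommRing A] {n : ℕ} (d D : ℕ) (f g : MvPolynomial (Fin (n + 1)) A)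
    (w : A) : Prop :=
  ∃ φ : wedgeRing n d D →+* A,
    (∀ α : Expo n d, φ (genT n d D α) = coeff α.1 f) ∧
    (∀ α : Expo n D, φ (genY n d D * genS n d D α) = coeff α.1 g) ∧
    w = φ (genY n d D) ^ d * φ (genW n d D)

open Classical in
/-- The wedge `f ∧ g ∈ A` of a form `f` of degree `d` and a splittable form `g` of degree `D`
(and `0` if it is not defined). -/
def wedge {A : Type u} [CommRing A] {n : ℕ} (d D : ℕ) (f g : MvPolynomial (Fin (n + 1)) A) : A :=
  if h : ∃ w : A, IsWedge d D f g w then h.choose else 0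

/-- The variables `X*_I = (X*_i : i ∈ I)`, where `X*_i` consists of `n i + 1` variables. -/
abbrev Vars {ι : Type v} (n : ι → ℕ) : Type v := Σ i : ι, Fin (n i + 1)

/-- The restriction of a family to `I \ {i}`. -/
abbrev del {ι : Type v} (n : ι → ℕ) (i : ι) : {j : ι // j ≠ i} → ℕ := fun j => n j.1

/-- The inclusion of the variables `X*_{I \ {i}}` in `X*_I`. -/
def inclVars {ι : Type v} (n : ι → ℕ) (i : ι) : Vars (del n i) → Vars n :=
  fun w => ⟨w.1.1, w.2⟩

open Classical in
/-- A polynomial in `A[X*_I]` regarded as a polynomial in `X*_i` over `A[X*_{I \ {i}}]`. -/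
def splitAt {A : Type u} [CommRing A] {ι : Type v} (n : ι → ℕ) (i : ι) :
    MvPolynomial (Vars n) A →ₐ[A]
      MvPolynomial (Fin (n i + 1)) (MvPolynomial (Vars (del n i)) A) :=
  aeval fun w : Vars n =>
    if h : w.1 = i then X (Fin.cast (by rw [h]) w.2)
    else C (X (⟨⟨w.1, h⟩, w.2⟩ : Vars (del n i)))

/-- The wedge `f ∧_i R ∈ A[X*_{I \ {i}}]` of a form `f ∈ A[X_i]` of degree `d` and of `R ∈ A[X*_I]`,
splittable of degree `D` in `X*_i`. -/
def wedgeAt {A : Type u} [CommRing A] {ι : Type v} (n : ι → ℕ) (i : ι) (d D : ℕ)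
    (f : MvPolynomial (Fin (n i + 1)) A) (R : MvPolynomial (Vars n) A) :
    MvPolynomial (Vars (del n i)) A :=
  wedge d D (map C f) (splitAt n i R)

/-- `R ∈ A[X*_I]` is a resultant in `X*_I` over `A`, homogeneous of degree `D i` in each `X*_i`
(the degrees are recorded since they are not determined by `R` when `R = 0`).
The definition is recursive on the finite set `I`. The algebras `B` range over the reduced
`A`-algebras, where the wedge has at most one value; when `A` is reduced they include the polynomial
rings over `A`, hence the indeterminate forms.
The identity `g ∧_j f ∧_i R = f ∧_i g ∧_j R` is stated in `B[X*_I]`. -/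
inductive IsResultant : ∀ {A : Type u} [CommRing A] {ι : Type v} (n : ι → ℕ) (_ : ι → ℕ)
    (_ : MvPolynomial (Vars n) A), Prop
  | intro {A : Type u} [CommRing A] {ι : Type v} (n D : ι → ℕ) (R : MvPolynomial (Vars n) A)
    (splittable : ∀ i : ι, IsSplittable (D i) (splitAt n i R))
    (wedge_isResultant : ∀ (i : ι) (B : Type u) [CommRing B] [IsReduced B] [Algebra A B] (d : ℕ)
      (f : MvPolynomial (Fin (n i + 1)) B), f.IsHomogeneous d →
        IsResultant (del n i) (fun j => d * D j.1)
          (wedgeAt n i d (D i) f (map (algebraMap A B) R)))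
    (wedge_comm : ∀ (i j : ι) (hji : j ≠ i) (B : Type u) [CommRing B] [IsReduced B] [Algebra A B]
      (d e : ℕ) (f : MvPolynomial (Fin (n i + 1)) B) (g : MvPolynomial (Fin (n j + 1)) B),
        f.IsHomogeneous d → g.IsHomogeneous e →
        rename (inclVars n i ∘ inclVars (del n i) ⟨j, hji⟩)
          (wedgeAt (del n i) ⟨j, hji⟩ e (d * D j) g
            (wedgeAt n i d (D i) f (map (algebraMap A B) R))) =
        rename (inclVars n j ∘ inclVars (del n j) ⟨i, hji.symm⟩)
          (wedgeAt (del n j) ⟨i, hji.symm⟩ d (e * D i) f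
            (wedgeAt n j e (D j) g (map (algebraMap A B) R)))) :
    IsResultant n D R

end ResultantWedge

end

/-! Let `r` be `R` seen as a form in `X*_i`: it is splittable, prime and not constant in `X*_i`. Put
`d = e + 1` and `w = F ∧ r`. Under a morphism to an algebraically closed field that does not kill
`r`, the image of `r` is some `c ∏ (X* · x_t)` and that of `w` is `c ^ d ∏ F(x_t)`
(`IsWedge.splitVal`). Hence two specialisations of `w` are known. Sending `F` to `(X · Z) ^ e (X ·
X')` gives `r(Z) ^ e r(X')` (`IsWedge.exists_specialization`), and sending `F` to `y F` gives `y ^ D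
w` (`IsWedge.exists_scaling`).

Suppose `w = p q`. The prime `r(X')` divides the image of one factor, say `p`, so the image of `q`
divides `r(Z) ^ e` and is free of `X'`. Putting `X' = 0` kills `T`, so this image is `q` at `T = 0`,
which is therefore nonzero. Under scaling, the image of `q` divides `y ^ D w` and is nonzero at `y =
0`, so it does not involve `y`; comparing `y = 0` and `y = 1`, `q` equals its value at `T = 0`. So
`q` has no `T`, no `X*_i`, and divides a power of the nonconstant prime `r`: it is a unit
(`irreducible_of_isWedge_indetForm`).

The remaining work is to produce points and values. `exists_split_of_hom` carries points along a
morphism defined only on the coefficients, because the products of coordinates `∏ x_t(j_t)` are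
integral over these (Kronecker). `exists_isWedge` shows that the value computed from points over an
algebraic closure is integral (`isIntegral_mul_prod_eval`) and lies in the fraction field
(`mem_range_of_splitVal`), hence in the integrally closed base ring. -/

namespace ResultantWedge

/-! ### Products of linear forms over a field: unique factorisation. -/

section

variable {σ : Type*} [Fintype σ]

/-- The linear form `∑ x_j X_j`. -/
noncomputable def linForm {K : Type*} [CommSemiring K] (x : σ → K) : MvPolynomial σ K :=
  ∑ j, C (x j) * X j

section CommSemiring
variable {K L : Type*} [CommSemiring K] [CommSemiring L]

theorem map_linForm (φ : K →+* L) (x : σ → K) : map φ (linForm x) = linForm (φ ∘ x) := by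
  simp [linForm]

theorem eval_linForm (x y : σ → K) : eval y (linForm x) = ∑ j, x j * y j := by
  simp [linForm]

theorem coeff_linForm [DecidableEq σ] (x : σ → K) (j : σ) :
    coeff (Finsupp.single j 1) (linForm x) = x j := by
  simp [linForm, coeff_sum, coeff_C_mul, coeff_X, Finsupp.single_left_inj]

theorem linForm_injective : Function.Injective (linForm : (σ → K) → MvPolynomial σ K) := by
  classical
  intro x y h
  funext j
  rw [← coeff_linForm x, h, coeff_linForm]

theorem linForm_smul (a : K) (x : σ → K) : linForm (a • x) = C a * linForm x := by
  simp [linForm, Finset.mul_sum, mul_assoc]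

theorem linForm_zero : linForm (0 : σ → K) = 0 := by simp [linForm]

theorem isHomogeneous_linForm (x : σ → K) : (linForm x).IsHomogeneous 1 :=
  IsHomogeneous.sum _ _ _ fun _ _ => isHomogeneous_C_mul_X _ _

theorem eval_smul_of_isHomogeneous {τ : Type*} {f : MvPolynomial τ K} {d : ℕ}
    (hf : f.IsHomogeneous d) (a : K) (x : τ → K) : eval (a • x) f = a ^ d * eval x f := by
  classical
  rw [eval_eq, eval_eq, Finset.mul_sum]
  refine Finset.sum_congr rfl fun m hm => ?_
  have h := hf (mem_support_iff.1 hm)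
  have h2 : ∑ i ∈ m.support, m i = d := by
    rw [← h, Finsupp.weight_apply, Finsupp.sum]; simp
  simp only [Pi.smul_apply, smul_eq_mul, mul_pow, Finset.prod_mul_distrib,
    Finset.prod_pow_eq_pow_sum, h2]
  ring

end CommSemiring

section Field
variable {K : Type*} [Field K]

theorem linForm_ne_zero {x : σ → K} (hx : x ≠ 0) : linForm x ≠ 0 := fun h =>
  hx (linForm_injective (h.trans (by simp [linForm])))

theorem prime_linForm {x : σ → K} (hx : x ≠ 0) : Prime (linForm x) := by
  classical
  rw [← UniqueFactorizationMonoid.irreducible_iff_prime]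
  have h0 := linForm_ne_zero hx
  refine irreducible_of_totalDegree_eq_one ((isHomogeneous_linForm x).totalDegree h0) fun a ha => ?_
  obtain ⟨j, hj⟩ := Function.ne_iff.1 hx
  refine isUnit_iff_ne_zero.2 fun h => hj ?_
  have := ha (Finsupp.single j 1)
  rw [coeff_linForm, h, zero_dvd_iff] at this
  simpa using this

theorem exists_eq_C_of_isUnit {τ : Type*} {p : MvPolynomial τ K} (hp : IsUnit p) :
    ∃ a : K, a ≠ 0 ∧ p = C a := by
  obtain ⟨a, ha, h⟩ := (isUnit_iff_eq_C_of_isReduced).1 hp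
  exact ⟨a, ha.ne_zero, h⟩

theorem exists_smul_eq_of_linForm_dvd {x y : σ → K} (hx : x ≠ 0) (hy : y ≠ 0)
    (h : linForm x ∣ linForm y) : ∃ a : K, a ≠ 0 ∧ y = a • x := by
  obtain ⟨u, hu⟩ := (prime_linForm hx).associated_of_dvd (prime_linForm hy) h
  obtain ⟨a, ha, h⟩ := exists_eq_C_of_isUnit u.isUnit
  refine ⟨a, ha, linForm_injective ?_⟩
  rw [linForm_smul, ← hu, h, mul_comm]

/-- `g` is a product of linear forms `c ∏ (X · x_t)` and `w = c ^ d ∏ f(x_t)`. -/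
def SplitVal (d : ℕ) (f g : MvPolynomial σ K) (w : K) : Prop :=
  ∃ (c : K) (s : Multiset (σ → K)), g = C c * (s.map linForm).prod ∧
    w = c ^ d * (s.map fun x => eval x f).prod

theorem SplitVal.mul {d : ℕ} {f g h : MvPolynomial σ K} {v w : K} (hg : SplitVal d f g v)
    (hh : SplitVal d f h w) : SplitVal d f (g * h) (v * w) := by
  obtain ⟨c, s, rfl, rfl⟩ := hg
  obtain ⟨c', s', rfl, rfl⟩ := hh
  refine ⟨c * c', s + s', ?_, ?_⟩ <;> simp <;> ring

theorem SplitVal.map {L : Type*} [Field L] {d : ℕ} {f g : MvPolynomial σ K} {w : K} (φ : K →+* L)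
    (h : SplitVal d f g w) :
    SplitVal d (MvPolynomial.map φ f) (MvPolynomial.map φ g) (φ w) := by
  obtain ⟨c, s, rfl, rfl⟩ := h
  refine ⟨φ c, s.map (φ ∘ ·), ?_, ?_⟩
  · simp [map_multiset_prod, Multiset.map_map, Function.comp_def, map_linForm]
  · rw [map_mul, map_pow, map_multiset_prod, Multiset.map_map, Multiset.map_map]
    simp only [Function.comp_def, map_eval]

theorem ne_zero_of_mem_of_prod_ne_zero {c : K} {s : Multiset (σ → K)}
    (h : C c * (s.map linForm).prod ≠ 0) : ∀ x ∈ s, x ≠ 0 := by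
  rintro x hx rfl
  refine h (mul_eq_zero_of_right _ (Multiset.prod_eq_zero ?_))
  exact Multiset.mem_map.2 ⟨0, hx, linForm_zero⟩

/-- Linear forms are prime, so each factor on one side matches a factor on the other up to a scalar
`a`. Moving `a` into the constant multiplies its `d`-th power by `a ^ d`, exactly as `f (a x) = a ^
d f x` requires. -/
theorem prod_eval_eq_of_prod_linForm_eq {d : ℕ} {f : MvPolynomial σ K} (hf : f.IsHomogeneous d)
    (s : Multiset (σ → K)) : ∀ (s' : Multiset (σ → K)) (c c' : K),
    C c * (s.map linForm).prod = C c' * (s'.map linForm).prod → C c * (s.map linForm).prod ≠ 0 →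
    c ^ d * (s.map fun x => eval x f).prod = c' ^ d * (s'.map fun x => eval x f).prod := by
  induction s using Multiset.induction with
  | empty =>
    intro s' c c' h h0
    rcases s'.empty_or_exists_mem with rfl | ⟨x, hx⟩
    · simp only [Multiset.map_zero, Multiset.prod_zero, mul_one] at h ⊢
      rw [C_injective _ _ h]
    · have hx0 := ne_zero_of_mem_of_prod_ne_zero (h ▸ h0) x hx
      have hc : c ≠ 0 := fun hc => h0 (by simp [hc])
      exact absurd (isUnit_of_dvd_unit
        ((Dvd.dvd.mul_left (Multiset.dvd_prod (Multiset.mem_map_of_mem _ hx)) _).trans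
          (by rw [← h]; simp : _ ∣ C c)) ((isUnit_iff_ne_zero.2 hc).map C))
        (prime_linForm hx0).not_isUnit
  | cons x s ih =>
    intro s' c c' h h0
    have hx0 := ne_zero_of_mem_of_prod_ne_zero h0 x (by simp)
    have hp := prime_linForm hx0
    have hc' : c' ≠ 0 := fun hc => h0 (by rw [h, hc]; simp)
    have hd : linForm x ∣ C c' * (s'.map linForm).prod := by
      rw [← h, Multiset.map_cons, Multiset.prod_cons]
      exact (Dvd.intro _ rfl).mul_left _
    have hd' : linForm x ∣ (s'.map linForm).prod :=
      (hp.dvd_or_dvd hd).resolve_left fun h' =>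
        hp.not_isUnit (isUnit_of_dvd_unit h' ((isUnit_iff_ne_zero.2 hc').map C))
    obtain ⟨y, hy, hxy⟩ := hp.exists_mem_multiset_map_dvd hd'
    obtain ⟨a, ha, rfl⟩ := exists_smul_eq_of_linForm_dvd hx0
      (ne_zero_of_mem_of_prod_ne_zero (h ▸ h0) y hy) hxy
    obtain ⟨t, rfl⟩ := Multiset.exists_cons_of_mem hy
    simp only [Multiset.map_cons, Multiset.prod_cons] at h h0 ⊢
    have := ih t c (c' * a) (mul_left_cancel₀ hp.ne_zero (by
      rw [linForm_smul] at h
      rw [C_mul]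
      linear_combination h)) (fun h' => h0 (by rw [mul_left_comm, h', mul_zero]))
    rw [eval_smul_of_isHomogeneous hf]
    linear_combination eval x f * this

theorem SplitVal.unique {d : ℕ} {f g : MvPolynomial σ K} {v w : K} (hf : f.IsHomogeneous d)
    (hg : g ≠ 0) (hv : SplitVal d f g v) (hw : SplitVal d f g w) : v = w := by
  obtain ⟨c, s, rfl, rfl⟩ := hv
  obtain ⟨c', s', h, rfl⟩ := hw
  exact prod_eval_eq_of_prod_linForm_eq hf s s' c c' h hg

theorem split_of_mul_eq (s : Multiset (σ → K)) : ∀ (c : K) (g h : MvPolynomial σ K),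
    g * h = C c * (s.map linForm).prod → g * h ≠ 0 →
    ∃ (a : K) (u v : Multiset (σ → K)), g = C a * (u.map linForm).prod ∧ s = u + v := by
  induction s using Multiset.induction with
  | empty =>
    intro c g h e h0
    have hc : c ≠ 0 := fun hc => h0 (by simp [e, hc])
    have : IsUnit (g * h) := by
      rw [e]; simpa using hc
    obtain ⟨a, -, ha⟩ := exists_eq_C_of_isUnit (isUnit_of_mul_isUnit_left this)
    exact ⟨a, 0, 0, by simp [ha], by simp⟩
  | cons x s ih =>
    intro c g h e h0
    have hp := prime_linForm (ne_zero_of_mem_of_prod_ne_zero (e ▸ h0) x (by simp))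
    rw [Multiset.map_cons, Multiset.prod_cons] at e
    rcases hp.dvd_or_dvd (Dvd.intro_left (C c * (s.map linForm).prod) (by rw [e]; ring) :
      linForm x ∣ g * h) with ⟨k, rfl⟩ | ⟨k, rfl⟩
    · obtain ⟨a, u, v, hk, rfl⟩ := ih c k h (mul_left_cancel₀ hp.ne_zero (by linear_combination e))
        (fun h' => h0 (by rw [mul_assoc, h', mul_zero]))
      exact ⟨a, x ::ₘ u, v, by rw [hk, Multiset.map_cons, Multiset.prod_cons]; ring, by simp⟩
    · obtain ⟨a, u, v, hk, rfl⟩ := ih c g k (mul_left_cancel₀ hp.ne_zero (by linear_combination e))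
        (fun h' => h0 (by rw [mul_left_comm, h', mul_zero]))
      exact ⟨a, u, x ::ₘ v, hk, by simp⟩

end Field

end

/-! ### Valuation rings, Gauss's lemma and integrality. -/

section

variable {σ τ : Type*} [Fintype σ] [Fintype τ]

/-- Divide by a coordinate of largest valuation; the zero vector is `0` times any primitive vector.
-/
theorem exists_smul_primitive [Nonempty σ] {L : Type*} [Field L] (V : ValuationSubring L)
    (x : σ → L) : ∃ (a : L) (y : σ → V), (∃ j, y j = 1) ∧ ∀ j, x j = a * y j := by
  obtain ⟨j, hj⟩ := Finite.exists_max fun j => V.valuation (x j)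
  by_cases h : x j = 0
  · refine ⟨0, fun _ => 1, ⟨j, rfl⟩, fun k => ?_⟩
    have := hj k
    rw [h, map_zero, le_zero_iff, map_eq_zero] at this
    simp [this]
  · refine ⟨x j, fun k => ⟨x k / x j, ?_⟩, ⟨j, Subtype.ext (div_self h)⟩, fun k => ?_⟩
    · rw [← V.valuation_le_one_iff, map_div₀]
      exact div_le_one_of_le₀ (hj k) zero_le
    · simp only
      field_simp

/-- Modulo the maximal ideal every factor stays nonzero, hence so does the product. -/
theorem exists_isUnit_coeff_prod_linForm {V : Type*} [CommRing V] [IsLocalRing V]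
    (y : τ → σ → V) (hy : ∀ t, ∃ j, y t j = 1) :
    ∃ m, IsUnit (coeff m (∏ t, linForm (y t))) := by
  have h : map (IsLocalRing.residue V) (∏ t, linForm (y t)) ≠ 0 := by
    rw [map_prod, Finset.prod_ne_zero_iff]
    intro t _
    rw [map_linForm]
    refine linForm_ne_zero fun h0 => ?_
    obtain ⟨j, hj⟩ := hy t
    simpa [hj] using congrFun h0 j
  obtain ⟨m, hm⟩ := ne_zero_iff.1 h
  refine ⟨m, ?_⟩
  rwa [coeff_map, ne_eq, IsLocalRing.residue_eq_zero_iff, IsLocalRing.mem_maximalIdeal,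
    mem_nonunits_iff, not_not] at hm

/-- Gauss's lemma for products of linear forms over a valuation ring. -/
theorem exists_primitive_of_coeff_mem [Nonempty σ] {L : Type*} [Field L] (V : ValuationSubring L)
    (c : L) (x : τ → σ → L) (h : ∀ m, coeff m (C c * ∏ t, linForm (x t)) ∈ V) :
    ∃ (a : τ → L) (y : τ → σ → V), c * ∏ t, a t ∈ V ∧ ∀ t j, x t j = a t * y t j := by
  choose a y hy hx using fun t => exists_smul_primitive V (x t)
  refine ⟨a, y, ?_, hx⟩
  obtain ⟨m, u, hu⟩ := exists_isUnit_coeff_prod_linForm y hy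
  have e : C c * ∏ t, linForm (x t) = C (c * ∏ t, a t) * map V.subtype (∏ t, linForm (y t)) := by
    rw [map_prod, C_mul, map_prod, mul_assoc, ← Finset.prod_mul_distrib]
    congr 1
    refine Finset.prod_congr rfl fun t _ => ?_
    rw [map_linForm, ← linForm_smul]
    congr 1
    funext j
    exact hx t j
  -- The coefficient at `m` is `c ∏ a_t` times a unit of `V`; the inverse of that unit isolates `c ∏
  -- a_t`.
  have h2 := V.mul_mem _ _ (h m) (u⁻¹ : Vˣ).1.2
  rwa [e, coeff_C_mul, coeff_map, ← hu, mul_assoc, ValuationSubring.subtype_apply,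
    ← MulMemClass.coe_mul, Units.mul_inv, OneMemClass.coe_one, mul_one] at h2

/-- The integral closure in a field is the intersection of the valuation rings containing the base.
-/
theorem isIntegral_of_forall_valuationSubring {R L : Type*} [CommRing R] [Field L] [Algebra R L]
    {x : L} (h : ∀ V : ValuationSubring L, (∀ r, algebraMap R L r ∈ V) → x ∈ V) :
    IsIntegral R x := by
  by_contra hx
  have : IsIntegrallyClosedIn (integralClosure R L).toSubring L :=
    inferInstanceAs (IsIntegrallyClosedIn (integralClosure R L) L)
  obtain ⟨V, hV, hxV⟩ := Subring.exists_le_valuationSubring_of_isIntegrallyClosedIn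
    (R := (integralClosure R L).toSubring) (x := x) hx
  exact hxV (h V fun r => hV ((integralClosure R L).algebraMap_mem r))

/-- With `x_t = a_t y_t`, `y_t` primitive over `V`, the value is `(c ∏ a_t) ^ d ∏ f(y_t)`, and
Gauss's lemma puts `c ∏ a_t` in `V`. -/
theorem isIntegral_mul_prod_eval [Nonempty σ] {R L : Type*} [CommRing R] [Field L] [Algebra R L]
    {d : ℕ} {f : MvPolynomial σ R} (hf : f.IsHomogeneous d) (g : MvPolynomial σ R) (c : L)
    (x : τ → σ → L) (h : map (algebraMap R L) g = C c * ∏ t, linForm (x t)) :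
    IsIntegral R (c ^ d * ∏ t, eval (x t) (map (algebraMap R L) f)) := by
  refine isIntegral_of_forall_valuationSubring fun V hV => ?_
  obtain ⟨a, y, ha, hx⟩ := exists_primitive_of_coeff_mem V c x fun m => by
    rw [← h, coeff_map]; exact hV _
  let ρ : R →+* V := (algebraMap R L).codRestrict V.toSubring hV
  have hρ : algebraMap R L = V.subtype.comp ρ := rfl
  have e : ∀ t, eval (x t) (map (algebraMap R L) f) = a t ^ d * V.subtype (eval (y t) (map ρ f)) := by
    intro t
    rw [map_eval, map_map, ← hρ, ← eval_smul_of_isHomogeneous (hf.map _)]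
    congr 2
    funext j
    exact hx t j
  rw [Finset.prod_congr rfl fun t _ => e t, Finset.prod_mul_distrib, Finset.prod_pow, ← mul_assoc,
    ← mul_pow, ← map_prod]
  exact V.mul_mem _ _ (pow_mem ha d) (SetLike.coe_mem _)

/-- Kronecker's theorem for products of linear forms. -/
theorem isIntegral_prod_of_map_eq {S P : Type*} [CommRing S] [CommRing P] [IsDomain P] [Algebra S P]
    (x : τ → σ → P) (g : MvPolynomial σ S) (hg : map (algebraMap S P) g = ∏ t, linForm (x t))
    (j : τ → σ) : IsIntegral S (∏ t, x t (j t)) := by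
  by_cases hσ : Nonempty σ
  · let Q := FractionRing P
    rw [← isIntegral_algHom_iff (IsScalarTower.toAlgHom S P Q) (IsFractionRing.injective P Q)]
    refine isIntegral_of_forall_valuationSubring fun V hV => ?_
    obtain ⟨a, y, ha, hx⟩ := exists_primitive_of_coeff_mem V (1 : Q)
      (fun t j => algebraMap P Q (x t j)) fun m => by
        have e : ∏ t, linForm (fun j => algebraMap P Q (x t j)) = map (algebraMap S Q) g := by
          rw [IsScalarTower.algebraMap_eq S P Q, ← map_map, hg, map_prod]
          exact Finset.prod_congr rfl fun t _ => (map_linForm _ _).symm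
        rw [C_1, one_mul, e, coeff_map]
        exact hV _
    rw [IsScalarTower.coe_toAlgHom', map_prod, Finset.prod_congr rfl fun t _ => hx t (j t),
      Finset.prod_mul_distrib]
    rw [one_mul] at ha
    exact V.mul_mem _ _ ha (prod_mem fun t _ => SetLike.coe_mem _)
  · have : IsEmpty τ := ⟨fun t => hσ ⟨j t⟩⟩
    simpa using isIntegral_one

/-- A morphism to an algebraically closed field extends to every integral extension. -/
theorem exists_extension_of_isIntegral {S T L : Type*} [CommRing S] [CommRing T] [Algebra S T]
    [Algebra.IsIntegral S T] (hinj : Function.Injective (algebraMap S T)) [Field L] [IsAlgClosed L]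
    (φ : S →+* L) : ∃ ψ : T →+* L, ∀ s, ψ (algebraMap S T s) = φ s := by
  have : (RingHom.ker φ).IsPrime := RingHom.ker_isPrime φ
  -- Lying over: `T ⧸ Q` is then integral over a subring of `L`, so it embeds in `L`.
  obtain ⟨Q, -, hQ, hQφ⟩ := Ideal.exists_ideal_over_prime_of_isIntegral (RingHom.ker φ)
    (⊥ : Ideal T) (by simp [← RingHom.ker_eq_comap_bot, (RingHom.injective_iff_ker_eq_bot _).1 hinj])
  let p := Q.comap (algebraMap S T)
  let φ' : S ⧸ p →+* L := Ideal.Quotient.lift p φ fun a ha => by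
    rwa [← RingHom.mem_ker, ← hQφ]
  have hφ' : Function.Injective φ' := RingHom.lift_injective_of_ker_le_ideal p _ hQφ.ge
  let _ : Algebra (S ⧸ p) L := φ'.toAlgebra
  have : Module.IsTorsionFree (S ⧸ p) L := Module.isTorsionFree_iff_algebraMap_injective.2 hφ'
  have : Module.IsTorsionFree (S ⧸ p) (T ⧸ Q) :=
    Module.isTorsionFree_iff_algebraMap_injective.2 Ideal.algebraMap_quotient_injective
  let ψ : T ⧸ Q →ₐ[S ⧸ p] L := IsAlgClosed.lift
  refine ⟨ψ.toRingHom.comp (Ideal.Quotient.mk Q), fun s => ?_⟩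
  exact ψ.commutes (Ideal.Quotient.mk p s)

end

/-! ### Transporting points along a morphism of the coefficients. -/

section

variable {σ τ : Type*} [Fintype σ] [Fintype τ]

theorem prod_prod_erase [DecidableEq τ] {M : Type*} [CommMonoid M] (f : τ → M) :
    ∏ t, ∏ s ∈ Finset.univ.erase t, f s = (∏ t, f t) ^ (Fintype.card τ - 1) := by
  rw [Finset.prod_comm' (t' := Finset.univ) (s' := fun s => Finset.univ.erase s)
    (by simp [eq_comm]), ← Finset.prod_pow]
  exact Finset.prod_congr rfl fun s _ => by simp

theorem prod_linForm_eq_sum {P : Type*} [CommSemiring P] [DecidableEq τ] (x : τ → σ → P) :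
    ∏ t, linForm (x t) = ∑ j : τ → σ, C (∏ t, x t (j t)) * ∏ t, X (j t) := by
  simp only [linForm]
  rw [Finset.prod_univ_sum, Fintype.piFinset_univ]
  exact Finset.sum_congr rfl fun j _ => by rw [Finset.prod_mul_distrib, map_prod]

/-- If the coefficients of a product of linear forms lie in a subring `S`, then every morphism from
`S` to an algebraically closed field is given by points wherever it does not kill the product. -/
theorem exists_split_of_hom {S P L : Type*} [CommRing S] [CommRing P] [IsDomain P] [Algebra S P]
    [Field L] [IsAlgClosed L] (hinj : Function.Injective (algebraMap S P)) (x : τ → σ → P)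
    (g : MvPolynomial σ S) (hg : map (algebraMap S P) g = ∏ t, linForm (x t))
    (φ : S →+* L) (h0 : map φ g ≠ 0) :
    ∃ (c : L) (y : τ → σ → L), map φ g = C c * ∏ t, linForm (y t) ∧
      ∀ (d : ℕ) (F : MvPolynomial σ S) (w : S), F.IsHomogeneous d →
        algebraMap S P w = ∏ t, eval (x t) (map (algebraMap S P) F) →
        φ w = c ^ d * ∏ t, eval (y t) (map φ F) := by
  classical
  let S' := integralClosure S P
  have hι : Function.Injective (algebraMap S' P) := Subtype.val_injective
  have hS' : Function.Injective (algebraMap S S') := fun a b h =>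
    hinj (congrArg (algebraMap S' P) h)
  obtain ⟨ψ, hψ⟩ := exists_extension_of_isIntegral hS' φ
  let z : (τ → σ) → S' := fun j => ⟨∏ t, x t (j t), isIntegral_prod_of_map_eq x g hg j⟩
  let G : MvPolynomial σ S' := ∑ j : τ → σ, C (z j) * ∏ t, X (j t)
  have hG : map (algebraMap S' P) G = ∏ t, linForm (x t) := by
    rw [prod_linForm_eq_sum]
    rw [map_sum]
    refine Finset.sum_congr rfl fun j _ => ?_
    rw [map_mul, map_C, map_prod]
    simp only [map_X]
    rfl
  have hψφ : ψ.comp (algebraMap S S') = φ := RingHom.ext hψ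
  have hGφ : map ψ G = map φ g := by
    rw [← hψφ, ← map_map]
    congr 1
    apply map_injective _ hι
    rw [hG, ← hg, map_map, ← IsScalarTower.algebraMap_eq]
  -- The `z j` are integral over `S`, so `ψ` is defined on them although the coordinates of the `x
  -- t` may not be integral. Not all of them die, as they determine `G`.
  obtain ⟨j₀, hj₀⟩ : ∃ j, ψ (z j) ≠ 0 := by
    by_contra! h
    refine h0 ?_
    rw [← hGφ]
    simp [G, h]
  -- Varying only the `t`-th index of `j₀` gives a multiple of the point `x t` whose coordinates lie
  -- in `S'`.
  let y : τ → σ → S' := fun t k => z (Function.update j₀ t k)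
  let b : τ → P := fun t => ∏ s ∈ Finset.univ.erase t, x s (j₀ s)
  have hy : ∀ t, algebraMap S' P ∘ y t = b t • x t := by
    intro t
    funext k
    have : algebraMap S' P (y t k) = ∏ s, x s (Function.update j₀ t k s) := rfl
    rw [Function.comp_apply, this, ← Finset.prod_erase_mul _ _ (Finset.mem_univ t),
      Function.update_self, Pi.smul_apply, smul_eq_mul]
    congr 1
    exact Finset.prod_congr rfl fun s hs => by rw [Function.update_of_ne (Finset.ne_of_mem_erase hs)]
  have hb : ∏ t, b t = algebraMap S' P (z j₀) ^ (Fintype.card τ - 1) := prod_prod_erase _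
  have hprod : ∏ t, linForm (y t) = C (z j₀ ^ (Fintype.card τ - 1)) * G := by
    apply map_injective _ hι
    rw [map_mul, hG, map_C, map_pow, ← hb, map_prod, map_prod, ← Finset.prod_mul_distrib]
    exact Finset.prod_congr rfl fun t _ => by rw [map_linForm, hy, linForm_smul]
  have hζ := pow_ne_zero (Fintype.card τ - 1) hj₀
  -- The constant undoes the multiples `b t`, whose product is a power of `z j₀`.
  refine ⟨(ψ (z j₀) ^ (Fintype.card τ - 1))⁻¹, fun t => ψ ∘ y t, ?_, fun d F w hF hw => ?_⟩
  · have : ∏ t, linForm (ψ ∘ y t) = C (ψ (z j₀) ^ (Fintype.card τ - 1)) * map ψ G := by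
      rw [← map_pow, ← map_C, ← map_mul, ← hprod, map_prod]
      exact Finset.prod_congr rfl fun t _ => (map_linForm _ _).symm
    rw [this, ← mul_assoc, ← C_mul, inv_mul_cancel₀ hζ, C_1, one_mul, hGφ]
  · have hev : ∏ t, eval (y t) (map (algebraMap S S') F) =
        (z j₀ ^ (Fintype.card τ - 1)) ^ d * algebraMap S S' w := by
      apply hι
      rw [map_mul, map_pow, map_pow, ← hb, ← IsScalarTower.algebraMap_apply]
      rw [hw, map_prod, ← Finset.prod_pow, ← Finset.prod_mul_distrib]
      refine Finset.prod_congr rfl fun t _ => ?_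
      rw [map_eval, map_map, ← IsScalarTower.algebraMap_eq, ← eval_smul_of_isHomogeneous (hF.map _)]
      congr 2
      exact hy t
    have := congrArg ψ hev
    rw [map_mul, hψ, map_pow, map_pow, map_prod] at this
    rw [inv_pow, eq_inv_mul_iff_mul_eq₀ (pow_ne_zero d hζ), ← this]
    refine Finset.prod_congr rfl fun t _ => ?_
    rw [map_eval, map_map, hψφ]

end

/-! ### Rationality: the value lies in the field of the coefficients. -/

section

variable {σ : Type*} [Fintype σ]

/-- The roots of the minimal polynomial are the images of `w`, so `w` is its only root and is purely
inseparable as well as separable. -/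
theorem mem_range_of_isSeparable_of_forall_algHom {K L : Type*} [Field K] [Field L] [Algebra K L]
    [IsAlgClosed L] [Algebra.IsAlgebraic K L] {w : L} (hs : IsSeparable K w)
    (h : ∀ ψ : L →ₐ[K] L, ψ w = w) : w ∈ (algebraMap K L).range := by
  have h1 : w ∈ perfectClosure K L := by
    classical
    rw [mem_perfectClosure_iff_natSepDegree_eq_one, Polynomial.natSepDegree_eq_of_isAlgClosed L]
    rw [Finset.card_eq_one]
    refine ⟨w, ?_⟩
    have hr := Algebra.IsAlgebraic.range_eval_eq_rootSet_minpoly (F := K) (K := L) L w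
    ext v
    rw [Finset.mem_singleton]
    have : v ∈ (minpoly K w).rootSet L ↔ v = w := by
      rw [← hr]
      exact ⟨by rintro ⟨ψ, rfl⟩; exact h ψ, by rintro rfl; exact ⟨AlgHom.id K L, rfl⟩⟩
    rw [← this, Polynomial.rootSet_def]
    simp
  have h2 : w ∈ separableClosure K L := hs
  have h3 : w ∈ separableClosure K L ⊓ perfectClosure K L := ⟨h2, h1⟩
  rw [separableClosure_inf_perfectClosure] at h3
  exact IntermediateField.mem_bot.1 h3

/-- Apply an `E`-linear retraction `L → E` to the coefficients of the quotient. -/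
theorem dvd_of_map_dvd_map {τ E L : Type*} [Field E] [Field L] [Algebra E L]
    {g h : MvPolynomial τ E} (H : map (algebraMap E L) g ∣ map (algebraMap E L) h) : g ∣ h := by
  classical
  obtain ⟨k, hk⟩ := H
  obtain ⟨π, hπ⟩ := (Algebra.linearMap E L).exists_leftInverse_of_injective
    (LinearMap.ker_eq_bot.2 (algebraMap E L).injective)
  have hπ1 : ∀ a : E, π (algebraMap E L a) = a := fun a => LinearMap.congr_fun hπ a
  let k' : MvPolynomial τ E := ∑ m ∈ k.support, monomial m (π (coeff m k))
  have hk' : ∀ m, coeff m k' = π (coeff m k) := by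
    intro m
    simp only [k', coeff_sum, coeff_monomial, Finset.sum_ite_eq', mem_support_iff]
    split_ifs with h0
    · rfl
    · rw [not_not.1 h0, map_zero]
  refine ⟨k', MvPolynomial.ext _ _ fun m => ?_⟩
  have := congrArg (fun p => π (coeff m p)) hk
  simp only [coeff_map, hπ1, coeff_mul, map_sum] at this
  rw [this, coeff_mul]
  refine Finset.sum_congr rfl fun n _ => ?_
  rw [hk', ← Algebra.smul_def, map_smul, smul_eq_mul]

theorem eval_pow_mem_range {τ E L : Type*} [Field E] [Field L] [Algebra E L] (q : ℕ) [ExpChar E q]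
    {x : τ → L} {k : ℕ}
    (hx : ∀ j, x j ^ q ^ k ∈ (algebraMap E L).range) (f : MvPolynomial τ E) :
    eval x (map (algebraMap E L) f) ^ q ^ k ∈ (algebraMap E L).range := by
  have := expChar_of_injective_algebraMap (algebraMap E L).injective q
  induction f using MvPolynomial.induction_on with
  | C a => rw [map_C, eval_C]; exact pow_mem (RingHom.mem_range_self _ a) _
  | add p r hp hr => rw [map_add, map_add, add_pow_expChar_pow]; exact add_mem hp hr
  | mul_X p j hp => rw [map_mul, map_mul, map_X, eval_X, mul_pow]; exact mul_mem hp (hx j)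

section PurelyInseparable
variable {E L : Type*} [Field E] [Field L] [Algebra E L] [IsPurelyInseparable E L]

/-- The minimal polynomial of `x` becomes `(X - x) ^ q ^ n` over `L`; it can be divided out of `B`
until the exponent is exhausted. -/
theorem exists_pow_dvd_of_map_eq_X_sub_C_pow (q : ℕ) [ExpChar E q] (x : L) :
    ∃ n : ℕ, x ^ q ^ n ∈ (algebraMap E L).range ∧ ∀ (a : L) (b : ℕ) (B : Polynomial E), a ≠ 0 →
      B.map (algebraMap E L) = Polynomial.C a * (Polynomial.X - Polynomial.C x) ^ b →
      q ^ n ∣ b := by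
  obtain ⟨n, hn⟩ := (minpoly.natSepDegree_eq_one_iff_eq_X_sub_C_pow (F := E) q).1
    (IsPurelyInseparable.natSepDegree_eq_one E x)
  refine ⟨n, ?_, fun a b => ?_⟩
  · have h := congrArg (Polynomial.eval 0) hn
    rw [Polynomial.eval_pow, Polynomial.eval_sub, Polynomial.eval_X, Polynomial.eval_C, zero_sub,
      neg_pow, ← Polynomial.coeff_zero_eq_eval_zero, Polynomial.coeff_map] at h
    refine ⟨(-1) ^ q ^ n * (minpoly E x).coeff 0, ?_⟩
    rw [map_mul, h, map_pow, map_neg, map_one, ← mul_assoc, ← mul_pow]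
    simp
  · induction b using Nat.strong_induction_on with
    | _ b ih =>
      intro B ha hB
      rcases Nat.eq_zero_or_pos b with rfl | hb
      · exact dvd_zero _
      obtain ⟨B', rfl⟩ : minpoly E x ∣ B := by
        refine minpoly.dvd _ _ ?_
        rw [← Polynomial.eval_map_algebraMap, hB]
        simp [hb.ne']
      have hX : (Polynomial.X - Polynomial.C x) ≠ 0 := Polynomial.X_sub_C_ne_zero x
      have hle : q ^ n ≤ b := by
        have h1 := congrArg Polynomial.natDegree hB
        rw [Polynomial.natDegree_C_mul ha, Polynomial.natDegree_pow, Polynomial.natDegree_X_sub_C,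
          mul_one, Polynomial.map_mul, hn, Polynomial.natDegree_mul (pow_ne_zero _ hX),
          Polynomial.natDegree_pow, Polynomial.natDegree_X_sub_C, mul_one] at h1
        · omega
        · rintro h0
          rw [Polynomial.map_mul, h0, mul_zero] at hB
          exact mul_ne_zero (Polynomial.C_ne_zero.2 ha) (pow_ne_zero b hX) hB.symm
      have hq : 0 < q ^ n := pow_pos (expChar_pos E q) n
      have := ih (b - q ^ n) (by omega) B' ha (mul_left_cancel₀ (pow_ne_zero (q ^ n) hX) (by
        rw [← hn, ← Polynomial.map_mul, hB, hn, mul_left_comm, ← pow_add, Nat.add_sub_cancel' hle]))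
      exact (Nat.dvd_sub_iff_left hle dvd_rfl).1 this

theorem exists_pow_dvd_of_map_eq_linForm_pow (q : ℕ) [ExpChar E q] (x : σ → L) {j₀ : σ}
    (hj₀ : x j₀ = 1) :
    ∃ k : ℕ, (∀ j, x j ^ q ^ k ∈ (algebraMap E L).range) ∧ ∀ (a : L) (b : ℕ)
      (u : MvPolynomial σ E), a ≠ 0 → map (algebraMap E L) u = C a * linForm x ^ b → q ^ k ∣ b := by
  classical
  choose n hn hdvd using fun j => exists_pow_dvd_of_map_eq_X_sub_C_pow (E := E) q (x j)
  have : Nonempty σ := ⟨j₀⟩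
  obtain ⟨j, hj⟩ := Finite.exists_max n
  refine ⟨n j, fun i => ?_, fun a b u ha hu => ?_⟩
  · rw [← Nat.add_sub_cancel' (hj i), pow_add, pow_mul]
    exact pow_mem (hn i) _
  · let v : σ → Polynomial E := Pi.single j₀ Polynomial.X - Pi.single j 1
    refine hdvd j a b (aeval v u) ha ?_
    have h1 : (aeval v u).map (algebraMap E L) =
        eval₂ Polynomial.C (fun l => (v l).map (algebraMap E L)) (map (algebraMap E L) u) := by
      rw [eval₂_map, aeval_def, ← Polynomial.coe_mapRingHom, ← coe_eval₂Hom, map_eval₂Hom]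
      simp only [coe_eval₂Hom]
      congr 1
      ext; simp
    rw [h1, hu, eval₂_mul, eval₂_pow, eval₂_C]
    congr 2
    simp only [linForm, eval₂_sum, eval₂_mul, eval₂_C, eval₂_X, v, Pi.sub_apply,
      Polynomial.map_sub, mul_sub, Finset.sum_sub_distrib]
    rw [Finset.sum_eq_single j₀ (by intro i _ hi; simp [hi]) (by simp),
      Finset.sum_eq_single j (by intro i _ hi; simp [hi]) (by simp)]
    simp [hj₀]

/-- By Frobenius the power `linForm x ^ q ^ k` has coefficients in `E`. A factor over `E` is a
scalar times `linForm x ^ b` with `b ≤ q ^ k` and `q ^ k ∣ b`, so it is trivial. -/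
theorem exists_prime_map_eq_linForm_pow (q : ℕ) [ExpChar E q] (x : σ → L) {j₀ : σ}
    (hj₀ : x j₀ = 1) :
    ∃ (k : ℕ) (H : MvPolynomial σ E), Prime H ∧ map (algebraMap E L) H = linForm x ^ q ^ k ∧
      ∀ j, x j ^ q ^ k ∈ (algebraMap E L).range := by
  have := expChar_of_injective_algebraMap (algebraMap E L).injective q
  have hx : x ≠ 0 := fun h => by simp [h] at hj₀
  have hp := prime_linForm hx
  obtain ⟨k, hk, hdvd⟩ := exists_pow_dvd_of_map_eq_linForm_pow (E := E) q x hj₀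
  choose a ha using hk
  have hq : 0 < q ^ k := pow_pos (expChar_pos E q) k
  let H : MvPolynomial σ E := ∑ j, C (a j) * X j ^ q ^ k
  have hH : map (algebraMap E L) H = linForm x ^ q ^ k := by
    have := expChar_of_injective_ringHom (C_injective σ L) q
    rw [linForm, sum_pow_char_pow]
    simp [H, mul_pow, ha]
  refine ⟨k, H, ?_, hH, fun j => ⟨a j, ha j⟩⟩
  have key : ∀ u v, H = u * v → ∃ (c : L) (b : ℕ), c ≠ 0 ∧ b ≤ q ^ k ∧
      map (algebraMap E L) u = C c * linForm x ^ b := by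
    intro u v huv
    have h1 : map (algebraMap E L) u * map (algebraMap E L) v =
        C 1 * ((Multiset.replicate (q ^ k) x).map linForm).prod := by
      rw [← map_mul, ← huv, hH]; simp
    have h0 : map (algebraMap E L) u * map (algebraMap E L) v ≠ 0 := by
      rw [← map_mul, ← huv, hH]; exact pow_ne_zero _ hp.ne_zero
    obtain ⟨c, s, t, hu, hst⟩ := split_of_mul_eq _ 1 _ _ h1 h0
    obtain ⟨b, hb, rfl⟩ := Multiset.le_replicate_iff.1 (hst ▸ Multiset.le_add_right s t)
    refine ⟨c, b, ?_, hb, by simpa using hu⟩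
    rintro rfl
    simp [hu] at h0
  have unit_of : ∀ u (c : L), map (algebraMap E L) u = C c * linForm x ^ 0 → c ≠ 0 → IsUnit u := by
    intro u c hu hc
    have : u ∣ 1 := dvd_of_map_dvd_map (L := L) (by
      rw [hu, pow_zero, mul_one, map_one]
      exact ((isUnit_iff_ne_zero.2 hc).map C).dvd)
    exact isUnit_of_dvd_one this
  rw [← UniqueFactorizationMonoid.irreducible_iff_prime]
  refine ⟨fun hu => ?_, fun u v huv => ?_⟩
  · have := hu.map (map (algebraMap E L))
    rw [hH, isUnit_pow_iff hq.ne'] at this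
    exact hp.not_isUnit this
  · obtain ⟨c, b, hc, hb, hu⟩ := key u v huv
    obtain ⟨c', b', hc', hb', hv⟩ := key v u (by rw [huv, mul_comm])
    rcases Nat.eq_zero_or_pos b with rfl | h
    · exact Or.inl (unit_of u c hu hc)
    · have hbq := Nat.le_antisymm hb (Nat.le_of_dvd h (hdvd c b u hc hu))
      have hd := congrArg totalDegree (show linForm x ^ q ^ k = C (c * c') * linForm x ^ (b + b') by
        rw [← hH, huv, map_mul, hu, hv, C_mul, pow_add]; ring)
      have hC : (C (c * c') : MvPolynomial σ L) ≠ 0 := C_ne_zero.2 (mul_ne_zero hc hc')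
      rw [((isHomogeneous_linForm x).pow _).totalDegree (pow_ne_zero _ hp.ne_zero),
        ((isHomogeneous_C _ _).mul ((isHomogeneous_linForm x).pow _)).totalDegree
          (mul_ne_zero hC (pow_ne_zero _ hp.ne_zero))] at hd
      obtain rfl : b' = 0 := by omega
      exact Or.inr (unit_of v c' hv hc')

/-- Strip from `g` a prime `H` over `E` that becomes `linForm x ^ q ^ k`. It contributes `f(x) ^ q ^
k` to the value, which lies in `E` by Frobenius. -/
theorem exists_splitVal_of_isPurelyInseparable {d : ℕ} (f : MvPolynomial σ E) (N : ℕ) :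
    ∀ (c : L) (s : Multiset (σ → L)) (g : MvPolynomial σ E), g.totalDegree = N → g ≠ 0 →
      map (algebraMap E L) g = C c * (s.map linForm).prod → ∃ w : E, SplitVal d
      (map (algebraMap E L) f) (map (algebraMap E L) g) (algebraMap E L w) := by
  induction N using Nat.strong_induction_on with
  | _ N ih =>
    intro c s g hN hg hs
    rcases s.empty_or_exists_mem with rfl | ⟨x, hx⟩
    · refine ⟨coeff 0 g ^ d, c, 0, hs, ?_⟩
      have := congrArg (coeff 0) hs
      rw [coeff_map] at this
      simp [this]
    · have hgL : map (algebraMap E L) g ≠ 0 := by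
        rwa [ne_eq, map_eq_zero_iff _ (map_injective _ (algebraMap E L).injective)]
      have hx0 := ne_zero_of_mem_of_prod_ne_zero (hs ▸ hgL) x hx
      obtain ⟨j₀, hj₀⟩ := Function.ne_iff.1 hx0
      obtain ⟨q, _⟩ := ExpChar.exists E
      obtain ⟨k, H, hHp, hH, hk⟩ := exists_prime_map_eq_linForm_pow (E := E) q ((x j₀)⁻¹ • x)
        (j₀ := j₀) (by simpa using inv_mul_cancel₀ hj₀)
      have hdvd : linForm ((x j₀)⁻¹ • x) ∣ map (algebraMap E L) g := by
        rw [hs, linForm_smul]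
        refine (((isUnit_iff_ne_zero.2 (inv_ne_zero hj₀)).map C).mul_left_dvd.2 ?_).mul_left _
        exact Multiset.dvd_prod (Multiset.mem_map_of_mem _ hx)
      -- Over `L` the linear form divides `g`, so `H` divides `g ^ q ^ k`; this descends to `E`,
      -- where `H` is prime.
      obtain ⟨g', rfl⟩ : H ∣ g := hHp.dvd_of_dvd_pow (n := q ^ k) (dvd_of_map_dvd_map (L := L) (by
        rw [hH, map_pow]; exact pow_dvd_pow_of_dvd hdvd _))
      have hg' : g' ≠ 0 := right_ne_zero_of_mul hg
      have hHd : 0 < H.totalDegree := by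
        rw [Nat.pos_iff_ne_zero]
        intro h0
        rw [totalDegree_eq_zero_iff_eq_C] at h0
        refine hHp.not_isUnit ?_
        rw [h0]
        refine (isUnit_iff_ne_zero.2 fun h => hHp.ne_zero ?_).map C
        rw [h0, h, C_0]
      rw [totalDegree_mul_of_isDomain hHp.ne_zero hg'] at hN
      rw [mul_comm, map_mul] at hs
      obtain ⟨c', u, v, hu, -⟩ := split_of_mul_eq s c _ _ hs (by rwa [← map_mul, mul_comm])
      obtain ⟨w, hw⟩ := ih g'.totalDegree (by omega) c' u g' rfl hg' hu
      obtain ⟨y, hy⟩ := eval_pow_mem_range (E := E) q hk f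
      refine ⟨y * w, ?_⟩
      rw [map_mul, map_mul]
      refine SplitVal.mul ⟨1, Multiset.replicate (q ^ k) ((x j₀)⁻¹ • x), ?_, ?_⟩ hw
      · rw [hH]; simp
      · rw [hy]; simp

end PurelyInseparable

/-- A `K`-endomorphism of `L` carries a splitting of `g` to another one, so uniqueness makes `w`
invariant. Over the separable closure the extension is purely inseparable, so `w` is also separable.
-/
theorem mem_range_of_splitVal {K L : Type*} [Field K] [Field L] [Algebra K L] [IsAlgClosed L]
    [Algebra.IsAlgebraic K L] {d : ℕ} {f g : MvPolynomial σ K} (hf : f.IsHomogeneous d)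
    (hg : g ≠ 0) {w : L} (h : SplitVal d (map (algebraMap K L) f) (map (algebraMap K L) g) w) :
    w ∈ (algebraMap K L).range := by
  have hgL : map (algebraMap K L) g ≠ 0 := by
    rwa [ne_eq, map_eq_zero_iff _ (map_injective _ (algebraMap K L).injective)]
  refine mem_range_of_isSeparable_of_forall_algHom ?_ fun ψ => ?_
  · rw [← mem_separableClosure_iff]
    let E := separableClosure K L
    have : IsPurelyInseparable E L := separableClosure.isPurelyInseparable K L
    have e : algebraMap K L = (algebraMap E L).comp (algebraMap K E) := rfl
    obtain ⟨c, s, hs, -⟩ := id h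
    rw [e, ← map_map] at hs
    obtain ⟨v, hv⟩ := exists_splitVal_of_isPurelyInseparable (d := d)
      (map (algebraMap K E) f) _ c s _ rfl
      (by rwa [ne_eq, map_eq_zero_iff _ (map_injective _ (algebraMap K E).injective)]) hs
    rw [map_map, map_map, ← e] at hv
    rw [h.unique (hf.map _) hgL hv]
    exact v.2
  · have := h.map (ψ : L →+* L)
    rw [map_map, map_map, AlgHom.comp_algebraMap] at this
    exact this.unique (hf.map _) hgL h

end

/-! ### Universal wedges, splittable forms and points. -/

theorem mem_finsuppAntidiag_univ {n D : ℕ} (m : Fin (n + 1) →₀ ℕ) :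
    m ∈ (Finset.univ : Finset (Fin (n + 1))).finsuppAntidiag D ↔ m.degree = D := by
  rw [Finset.mem_finsuppAntidiag, Finsupp.degree_eq_sum]
  simp

theorem ext_of_isHomogeneous {K : Type*} [CommSemiring K] {n D : ℕ}
    {p q : MvPolynomial (Fin (n + 1)) K} (hp : p.IsHomogeneous D) (hq : q.IsHomogeneous D)
    (h : ∀ α : Expo n D, coeff α.1 p = coeff α.1 q) : p = q := by
  ext m
  by_cases hm : m.degree = D
  · exact h ⟨m, (mem_finsuppAntidiag_univ m).2 hm⟩
  · rw [hp.coeff_eq_zero hm, hq.coeff_eq_zero hm]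

theorem isHomogeneous_sum_expo {K : Type*} [CommSemiring K] {n D : ℕ} (a : Expo n D → K) :
    (∑ α : Expo n D, monomial α.1 (a α)).IsHomogeneous D :=
  IsHomogeneous.sum _ _ _ fun α _ =>
    isHomogeneous_monomial _ ((mem_finsuppAntidiag_univ α.1).1 α.2)

theorem coeff_sum_expo {K : Type*} [CommSemiring K] {n D : ℕ} (a : Expo n D → K) (β : Expo n D) :
    coeff β.1 (∑ α : Expo n D, monomial α.1 (a α)) = a β := by
  classical
  simp only [coeff_sum, coeff_monomial]
  rw [Finset.sum_eq_single β (fun α _ h => if_neg fun h' => h (Subtype.ext h')) (by simp), if_pos rfl]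

theorem isHomogeneous_prod_linForm {σ τ K : Type*} [Fintype σ] [Fintype τ] [CommSemiring K]
    (x : τ → σ → K) : (∏ t, linForm (x t)).IsHomogeneous (Fintype.card τ) := by
  simpa using IsHomogeneous.prod Finset.univ _ (fun _ => 1) fun t _ => isHomogeneous_linForm (x t)

theorem univSymm_eq_coeff (n d D : ℕ) (α : Expo n D) :
    univSymm n d D α = coeff α.1 (∏ t : Fin D, linForm fun j : Fin (n + 1) =>
      (X (UVar.pt t j) : MvPolynomial (UVar n d D) ℤ)) := by
  have := coeff_map
    (rename (R := ℤ) fun v : Fin D × Fin (n + 1) => (UVar.pt v.1 v.2 : UVar n d D)).toRingHom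
    (genericProduct n D) α.1
  refine this.symm.trans ?_
  congr 1
  simp [genericProduct, linForm]

theorem univWedge_eq_prod_eval (n d D : ℕ) :
    univWedge n d D = ∏ t : Fin D, eval (fun j : Fin (n + 1) => X (UVar.pt t j))
      (∑ α : Expo n d, monomial α.1 (X (UVar.T α) : MvPolynomial (UVar n d D) ℤ)) := by
  simp only [univWedge, map_sum, eval_monomial]
  refine Finset.prod_congr rfl fun t _ => Finset.sum_congr rfl fun α _ => ?_
  rw [Finsupp.prod_fintype _ _ (by simp)]

/-- Over an algebraically closed field the value of a wedge is given by the points of `g`. -/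
theorem IsWedge.splitVal {A L : Type*} [CommRing A] [Field L] [IsAlgClosed L] {n d D : ℕ}
    {f g : MvPolynomial (Fin (n + 1)) A} (hf : f.IsHomogeneous d) (hg : g.IsHomogeneous D) {w : A}
    (h : IsWedge d D f g w) (ψ : A →+* L) (h0 : map ψ g ≠ 0) :
    SplitVal d (map ψ f) (map ψ g) (ψ w) := by
  obtain ⟨φ, hT, hS, rfl⟩ := h
  let x : Fin D → Fin (n + 1) → MvPolynomial (UVar n d D) ℤ := fun t j => X (UVar.pt t j)
  let G : MvPolynomial (Fin (n + 1)) (wedgeRing n d D) :=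
    ∑ α : Expo n D, monomial α.1 (genS n d D α)
  let F : MvPolynomial (Fin (n + 1)) (wedgeRing n d D) :=
    ∑ α : Expo n d, monomial α.1 (genT n d D α)
  have hG : map (algebraMap (wedgeRing n d D) (MvPolynomial (UVar n d D) ℤ)) G =
      ∏ t, linForm (x t) := by
    refine ext_of_isHomogeneous ((isHomogeneous_sum_expo _).map _)
      (by simpa using isHomogeneous_prod_linForm x) fun α => ?_
    rw [coeff_map, coeff_sum_expo]
    exact univSymm_eq_coeff n d D α
  have hF : map (ψ.comp φ) F = map ψ f := by
    refine ext_of_isHomogeneous ((isHomogeneous_sum_expo _).map _) (hf.map _) fun α => ?_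
    rw [coeff_map, coeff_sum_expo, coeff_map, RingHom.comp_apply, hT]
  have hgG : map ψ g = C (ψ (φ (genY n d D))) * map (ψ.comp φ) G := by
    refine ext_of_isHomogeneous (hg.map _) (((isHomogeneous_sum_expo _).map _).C_mul _) fun α => ?_
    rw [coeff_map, ← hS, map_mul, map_mul, coeff_C_mul, coeff_map, coeff_sum_expo]
    rfl
  obtain ⟨c, y, hc, hW⟩ := exists_split_of_hom Subtype.val_injective x G hG (ψ.comp φ) (by
    intro h
    rw [hgG, h, mul_zero] at h0
    exact h0 rfl)
  have hw := hW d F (genW n d D) (isHomogeneous_sum_expo _) (by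
    have h1 : map (algebraMap (wedgeRing n d D) (MvPolynomial (UVar n d D) ℤ)) F =
        ∑ α : Expo n d, monomial α.1 (X (UVar.T α)) := by
      rw [map_sum]
      exact Finset.sum_congr rfl fun α _ => map_monomial _ _ _
    exact (univWedge_eq_prod_eval n d D).trans (by rw [h1]))
  rw [hF] at hw
  refine ⟨ψ (φ (genY n d D)) * c, Finset.univ.val.map y, ?_, ?_⟩
  · rw [hgG, hc, C_mul, mul_assoc, Multiset.map_map]
    rfl
  · rw [Multiset.map_map, map_mul, map_pow, mul_pow, mul_assoc]
    congr 1

/-- Splittability says precisely that evaluation at the coefficients of `g` factors through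
`ℤ[σ_D]`. -/
theorem exists_ringHom_of_isSplittable {A : Type*} [CommRing A] {n D : ℕ} (hD : 0 < D)
    {g : MvPolynomial (Fin (n + 1)) A} (hg : IsSplittable D g) :
    ∃ φ : (aeval (R := ℤ) (elemSymm n D)).range →+* A,
      ∀ α : Expo n D, φ ((aeval (R := ℤ) (elemSymm n D)).rangeRestrict (X α)) = coeff α.1 g := by
  let e : MvPolynomial (Expo n D) ℤ →+* (aeval (R := ℤ) (elemSymm n D)).range :=
    (aeval (R := ℤ) (elemSymm n D)).rangeRestrict
  have he : Function.Surjective e := (aeval (R := ℤ) (elemSymm n D)).rangeRestrict_surjective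
  let g' : MvPolynomial (Expo n D) ℤ →+* A :=
    ((aeval fun α : Expo n D => coeff α.1 g : MvPolynomial (Expo n D) ℤ →ₐ[ℤ] A))
  have hker : RingHom.ker e ≤ RingHom.ker g' := fun P hP =>
    hg.2 hD P (congrArg Subtype.val hP)
  refine ⟨e.liftOfSurjective he ⟨g', hker⟩, fun α => ?_⟩
  exact (RingHom.liftOfRightInverse_comp_apply e _ _ ⟨g', hker⟩ (X α)).trans (aeval_X _ _)

/-- The first point absorbs the constant, whence `0 < D`. -/
theorem exists_eq_prod_linForm {σ L : Type*} [Fintype σ] [Field L] {D : ℕ} (hD : 0 < D) (c : L)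
    (y : Fin D → σ → L) : ∃ y' : Fin D → σ → L, C c * ∏ t, linForm (y t) = ∏ t, linForm (y' t) := by
  obtain ⟨D, rfl⟩ := Nat.exists_eq_succ_of_ne_zero hD.ne'
  refine ⟨Fin.cons (c • y 0) fun t => y t.succ, ?_⟩
  simp [Fin.prod_univ_succ, linForm_smul, mul_assoc]

/-- A nonzero splittable form of positive degree splits over every algebraically closed field. -/
theorem IsSplittable.exists_eq_prod_linForm {A L : Type*} [CommRing A] [Field L] [IsAlgClosed L]
    {n D : ℕ} (hD : 0 < D) {g : MvPolynomial (Fin (n + 1)) A} (hg : IsSplittable D g)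
    (ψ : A →+* L) (h0 : map ψ g ≠ 0) :
    ∃ y : Fin D → Fin (n + 1) → L, map ψ g = ∏ t, linForm (y t) := by
  obtain ⟨φ, hφ⟩ := exists_ringHom_of_isSplittable hD hg
  let x : Fin D → Fin (n + 1) → MvPolynomial (Fin D × Fin (n + 1)) ℤ := fun t j => X (t, j)
  let e := (aeval (R := ℤ) (elemSymm n D)).rangeRestrict
  let G := ∑ α : Expo n D, monomial α.1 (e (X α))
  have hG : map (algebraMap (aeval (R := ℤ) (elemSymm n D)).range
      (MvPolynomial (Fin D × Fin (n + 1)) ℤ)) G = ∏ t, linForm (x t) := by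
    refine ext_of_isHomogeneous ((isHomogeneous_sum_expo _).map _)
      (by simpa using isHomogeneous_prod_linForm x) fun α => ?_
    rw [coeff_map, coeff_sum_expo]
    exact aeval_X _ _
  have hg' : map (ψ.comp φ) G = map ψ g := by
    refine ext_of_isHomogeneous ((isHomogeneous_sum_expo _).map _) (hg.1.map _) fun α => ?_
    rw [coeff_map, coeff_sum_expo, coeff_map, RingHom.comp_apply, hφ]
  obtain ⟨c, y, hc, -⟩ := exists_split_of_hom Subtype.val_injective x G hG (ψ.comp φ)
    (by rwa [hg'])
  obtain ⟨y', hy'⟩ := ResultantWedge.exists_eq_prod_linForm hD c y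
  exact ⟨y', by rw [← hy', ← hc, hg']⟩

theorem map_mem_of_mem_adjoin {P L : Type*} [CommRing P] [Algebra ℤ P] [CommRing L] {s : Set P}
    (Φ : P →+* L) (I : Subring L) (h : ∀ p ∈ s, Φ p ∈ I) : ∀ p ∈ Algebra.adjoin ℤ s, Φ p ∈ I := by
  intro p hp
  induction hp using Algebra.adjoin_induction with
  | mem p hp => exact h p hp
  | algebraMap r => rw [eq_intCast, map_intCast]; exact intCast_mem I r
  | add p q _ _ hp hq => rw [map_add]; exact add_mem hp hq
  | mul p q _ _ hp hq => rw [map_mul]; exact mul_mem hp hq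

theorem exists_ringHom_of_forall_mem_range {S A L : Type*} [CommRing S] [CommRing A] [CommRing L]
    {i : A →+* L} (hi : Function.Injective i) (Φ : S →+* L) (h : ∀ s, Φ s ∈ i.range) :
    ∃ φ : S →+* A, ∀ s, i (φ s) = Φ s := by
  have hb : Function.Bijective i.rangeRestrict :=
    ⟨fun a b hab => hi (congrArg Subtype.val hab), i.rangeRestrict_surjective⟩
  refine ⟨((RingEquiv.ofBijective _ hb).symm : i.range →+* A).comp (Φ.codRestrict _ h), fun s => ?_⟩
  exact congrArg Subtype.val ((RingEquiv.ofBijective _ hb).apply_symm_apply ⟨Φ s, h s⟩)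

theorem map_mem_of_mem_wedgeRing {L : Type*} [CommRing L] {n d D : ℕ}
    (Φ : MvPolynomial (UVar n d D) ℤ →+* L) (I : Subring L) (hT : ∀ α, Φ (X (UVar.T α)) ∈ I)
    (hY : Φ (X UVar.Y) ∈ I) (hS : ∀ α, Φ (univSymm n d D α) ∈ I) (hW : Φ (univWedge n d D) ∈ I) :
    ∀ p ∈ wedgeRing n d D, Φ p ∈ I := by
  apply map_mem_of_mem_adjoin
  rintro _ (((⟨α, rfl⟩ | rfl) | ⟨α, rfl⟩) | rfl)
  exacts [hT α, hY, hS α, hW]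

/-- The morphism on `ℤ[T, Y, X_t]` given by a form, a scalar and points. -/
noncomputable def pointHom {L : Type*} [CommRing L] {n d D : ℕ} (f : MvPolynomial (Fin (n + 1)) L)
    (y : Fin D → Fin (n + 1) → L) : MvPolynomial (UVar n d D) ℤ →+* L :=
  eval₂Hom (Int.castRingHom L) fun u => match u with
    | .T α => coeff α.1 f
    -- The scalar is `1`: the points are those of a product of linear forms without constant.
    | .Y => 1
    | .pt t j => y t j

section pointHom
variable {L : Type*} [CommRing L] {n d D : ℕ} (f : MvPolynomial (Fin (n + 1)) L)
  (y : Fin D → Fin (n + 1) → L)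

theorem pointHom_T (α : Expo n d) : pointHom (d := d) f y (X (UVar.T α)) = coeff α.1 f :=
  eval₂Hom_X' _ _ _

theorem pointHom_Y : pointHom (d := d) f y (X UVar.Y) = 1 :=
  eval₂Hom_X' _ _ _

theorem pointHom_pt (t : Fin D) (j : Fin (n + 1)) :
    pointHom (d := d) f y (X (UVar.pt t j)) = y t j :=
  eval₂Hom_X' _ _ _

theorem pointHom_univSymm (α : Expo n D) :
    pointHom f y (univSymm n d D α) = coeff α.1 (∏ t, linForm (y t)) := by
  rw [univSymm_eq_coeff, ← coeff_map, map_prod]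
  congr 1
  refine Finset.prod_congr rfl fun t _ => ?_
  rw [map_linForm]
  congr 1
  funext j
  exact pointHom_pt f y t j

theorem pointHom_univWedge (hf : f.IsHomogeneous d) :
    pointHom f y (univWedge n d D) = ∏ t, eval (y t) f := by
  rw [univWedge_eq_prod_eval, map_prod]
  refine Finset.prod_congr rfl fun t _ => ?_
  rw [map_eval]
  congr 1
  · congr 1
    funext j
    exact pointHom_pt f y t j
  · refine ext_of_isHomogeneous ((isHomogeneous_sum_expo _).map _) hf fun α => ?_
    rw [coeff_map, coeff_sum_expo, pointHom_T]

end pointHom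

/-- The point morphism sends every generator of `wedgeRing` into the image of `A`, so on that ring
it factors through `A`. -/
theorem exists_isWedge_of_points {A L : Type*} [CommRing A] [CommRing L] {i : A →+* L}
    (hi : Function.Injective i) {n d D : ℕ} {f g : MvPolynomial (Fin (n + 1)) A}
    (hf : f.IsHomogeneous d) (y : Fin D → Fin (n + 1) → L) (hy : map i g = ∏ t, linForm (y t))
    (hw : ∏ t, eval (y t) (map i f) ∈ i.range) : ∃ w, IsWedge d D f g w := by
  let Φ : MvPolynomial (UVar n d D) ℤ →+* L := pointHom (map i f) y
  have hS : ∀ α, Φ (univSymm n d D α) = i (coeff α.1 g) := fun α => by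
    rw [pointHom_univSymm, ← hy, coeff_map]
  have hT : ∀ α, Φ (X (UVar.T α)) = i (coeff α.1 f) := fun α => by
    rw [pointHom_T, coeff_map]
  have hle : ∀ s : wedgeRing n d D, Φ.comp (wedgeRing n d D).val.toRingHom s ∈ i.range :=
    fun s => map_mem_of_mem_wedgeRing Φ i.range (fun α => hT α ▸ i.mem_range_self _)
      (by rw [pointHom_Y]; exact one_mem _) (fun α => hS α ▸ i.mem_range_self _)
      (by rwa [pointHom_univWedge _ _ (hf.map i)]) s.1 s.2
  obtain ⟨φ, hφ⟩ := exists_ringHom_of_forall_mem_range hi _ hle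
  refine ⟨_, φ, fun α => hi ((hφ _).trans (hT α)), fun α => hi ?_, rfl⟩
  rw [map_mul, map_mul, hφ, hφ]
  exact (congrArg₂ _ (pointHom_Y _ _) (hS α)).trans (one_mul _)

/-- Over an integrally closed domain the wedge is defined. -/
theorem exists_isWedge {A : Type*} [CommRing A] [IsDomain A] [IsIntegrallyClosed A] {n d D : ℕ}
    (hD : 0 < D) {f g : MvPolynomial (Fin (n + 1)) A} (hf : f.IsHomogeneous d)
    (hg : IsSplittable D g) (h0 : g ≠ 0) : ∃ w, IsWedge d D f g w := by
  let K := FractionRing A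
  let L := AlgebraicClosure K
  have hi : Function.Injective (algebraMap A L) := by
    rw [IsScalarTower.algebraMap_eq A K L]
    exact (algebraMap K L).injective.comp (IsFractionRing.injective A K)
  have hiK : Function.Injective (algebraMap A K) := IsFractionRing.injective A K
  obtain ⟨y, hy⟩ := hg.exists_eq_prod_linForm hD (algebraMap A L) (by
    rwa [ne_eq, map_eq_zero_iff _ (map_injective _ hi)])
  refine exists_isWedge_of_points hi hf y hy ?_
  have hint := isIntegral_mul_prod_eval hf g 1 y (by rw [hy, C_1, one_mul])
  rw [one_pow, one_mul] at hint
  -- Integrality alone is not enough: the value must also descend from `L` to the fraction field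
  -- `K`.
  obtain ⟨k, hk⟩ : ∏ t, eval (y t) (map (algebraMap A L) f) ∈ (algebraMap K L).range := by
    refine mem_range_of_splitVal (hf.map (algebraMap A K)) (g := map (algebraMap A K) g)
      (by rwa [ne_eq, map_eq_zero_iff _ (map_injective _ hiK)]) ?_
    rw [map_map, map_map, ← IsScalarTower.algebraMap_eq]
    refine ⟨1, Finset.univ.val.map y, ?_, ?_⟩
    · rw [hy, C_1, one_mul, Multiset.map_map]; rfl
    · rw [one_pow, one_mul, Multiset.map_map]; rfl
  rw [← hk, isIntegral_algebraMap_iff (algebraMap K L).injective] at hint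
  obtain ⟨a, ha⟩ := IsIntegrallyClosed.isIntegral_iff.1 hint
  exact ⟨a, by rw [IsScalarTower.algebraMap_apply A K L, ha, hk]⟩

/-! ### Values of a wedge under specialisation. -/

theorem exists_injective_isAlgClosed (A : Type*) [CommRing A] [IsDomain A] :
    ∃ i : A →+* AlgebraicClosure (FractionRing A), Function.Injective i :=
  ⟨(algebraMap (FractionRing A) _).comp (algebraMap A _),
    (algebraMap (FractionRing A) _).injective.comp (IsFractionRing.injective A _)⟩

theorem card_eq_of_isHomogeneous {σ K : Type*} [Fintype σ] [Field K] {D : ℕ} {c : K}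
    {s : Multiset (σ → K)} (h : (C c * (s.map linForm).prod).IsHomogeneous D)
    (h0 : C c * (s.map linForm).prod ≠ 0) : s.card = D := by
  have hs : (s.map linForm).prod.IsHomogeneous s.card := by
    clear h h0
    induction s using Multiset.induction with
    | empty => simpa using isHomogeneous_one _ _
    | cons x s ih =>
      rw [Multiset.map_cons, Multiset.prod_cons, Multiset.card_cons, add_comm]
      exact (isHomogeneous_linForm x).mul ih
  exact (hs.C_mul c).inj_right h h0

/-- Both images of `g` have the same `D` points, and each contributes one factor `a`. -/
theorem IsWedge.eq_pow_mul {A B : Type*} [CommRing A] [CommRing B] [IsDomain B] {n d D : ℕ}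
    {f g : MvPolynomial (Fin (n + 1)) A} (hf : f.IsHomogeneous d) (hg : g.IsHomogeneous D) {w : A}
    (h : IsWedge d D f g w) (ψ₁ ψ₂ : A →+* B) {a : B} (hψf : map ψ₂ f = C a * map ψ₁ f)
    (hψg : map ψ₂ g = map ψ₁ g) (h0 : map ψ₁ g ≠ 0) : ψ₂ w = a ^ D * ψ₁ w := by
  obtain ⟨i, hi⟩ := exists_injective_isAlgClosed B
  have h0' : map (i.comp ψ₁) g ≠ 0 := by
    rwa [← map_map, ne_eq, map_eq_zero_iff _ (map_injective _ hi)]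
  have hg₂ : map (i.comp ψ₂) g = map (i.comp ψ₁) g := by rw [← map_map, hψg, map_map]
  have hf₂ : map (i.comp ψ₂) f = C (i a) * map (i.comp ψ₁) f := by
    rw [← map_map, hψf, map_mul, map_C, map_map]
  have h2 := h.splitVal hf hg (i.comp ψ₂) (by rwa [hg₂])
  obtain ⟨c, s, hc, hw⟩ := h.splitVal hf hg (i.comp ψ₁) h0'
  apply hi
  refine h2.unique (hf.map _) (by rwa [hg₂]) ⟨c, s, hg₂.trans hc, ?_⟩
  have hs : s.card = D := card_eq_of_isHomogeneous (hc ▸ hg.map _) (hc ▸ h0')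
  rw [map_mul, map_pow]
  refine (congrArg _ hw).trans ?_
  simp only [hf₂, map_mul, eval_C, Multiset.prod_map_mul, Multiset.map_const',
    Multiset.prod_replicate, hs]
  ring

/-- The wedge with a product of linear forms is the product of the values of `g`. -/
theorem IsWedge.eq_of_linForm {A B : Type*} [CommRing A] [CommRing B] [IsDomain B] {n e D : ℕ}
    {f g : MvPolynomial (Fin (n + 1)) A} (hf : f.IsHomogeneous (e + 1)) (hg : g.IsHomogeneous D)
    {w : A} (h : IsWedge (e + 1) D f g w) (ψ : A →+* B) (z x : Fin (n + 1) → B)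
    (hψ : map ψ f = linForm z ^ e * linForm x) (h0 : map ψ g ≠ 0) :
    ψ w = eval z (map ψ g) ^ e * eval x (map ψ g) := by
  obtain ⟨i, hi⟩ := exists_injective_isAlgClosed B
  obtain ⟨c, s, hc, hw⟩ := h.splitVal hf hg (i.comp ψ) (by
    rwa [← map_map, ne_eq, map_eq_zero_iff _ (map_injective _ hi)])
  -- Duality: the linear form of `v` at a point `y` of `g` is the factor of `g` belonging to `y`,
  -- evaluated at `v`.
  have key : ∀ v : Fin (n + 1) → B, i (eval v (map ψ g)) =
      c * (s.map fun y => eval y (linForm (i ∘ v))).prod := by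
    intro v
    rw [map_eval, map_map, hc, map_mul, eval_C, map_multiset_prod, Multiset.map_map]
    congr 3
    funext y
    simp only [Function.comp_apply, eval_linForm, mul_comm]
  apply hi
  rw [map_mul, map_pow, key, key]
  refine hw.trans ?_
  rw [← map_map, hψ, map_mul, map_pow, map_linForm, map_linForm]
  simp only [map_mul, map_pow, Multiset.prod_map_mul, Multiset.prod_map_pow]
  ring

/-! ### Separating the variables `X*_i`. -/

theorem splitAt_C {A ι : Type*} [CommRing A] (n : ι → ℕ) (i : ι) (a : A) :
    splitAt n i (C a) = C (C a) :=
  aeval_C _ _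

theorem splitAt_X_self {A ι : Type*} [CommRing A] (n : ι → ℕ) (i : ι) (j : Fin (n i + 1)) :
    splitAt (A := A) n i (X ⟨i, j⟩) = X j := by
  simp [splitAt]

theorem splitAt_X_incl {A ι : Type*} [CommRing A] (n : ι → ℕ) (i : ι) (v : Vars (del n i)) :
    splitAt (A := A) n i (X (inclVars n i v)) = C (X v) := by
  simp [splitAt, inclVars, v.1.2]

/-- `splitAt` as an isomorphism. -/
noncomputable def splitEquiv (A : Type*) {ι : Type*} [CommRing A] (n : ι → ℕ) (i : ι) :
    MvPolynomial (Vars n) A ≃ₐ[A] MvPolynomial (Fin (n i + 1)) (MvPolynomial (Vars (del n i)) A) :=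
  AlgEquiv.ofAlgHom (splitAt n i)
    (aevalTower (rename (inclVars n i)) fun j => X ⟨i, j⟩)
    (by
      ext v : 2
      · ext w
        simp [splitAt_X_incl]
      · simp [splitAt_X_self])
    (by
      ext ⟨k, j⟩ : 1
      by_cases h : k = i
      · subst h
        simp [splitAt_X_self]
      · have : (⟨k, j⟩ : Vars n) = inclVars n i ⟨⟨k, h⟩, j⟩ := rfl
        rw [this]
        simp [splitAt_X_incl])

theorem splitAt_map {A B ι : Type*} [CommRing A] [CommRing B] (φ : A →+* B) (n : ι → ℕ) (i : ι)
    (R : MvPolynomial (Vars n) A) : splitAt n i (map φ R) = map (map φ) (splitAt n i R) := by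
  induction R using MvPolynomial.induction_on with
  | C a =>
    rw [map_C, splitAt_C, splitAt_C, map_C, map_C]
  | add p q hp hq => simp only [map_add, hp, hq]
  | mul_X p v hp =>
    rw [map_mul, map_mul, map_mul, map_mul, hp, map_X]
    congr 1
    obtain ⟨k, j⟩ := v
    by_cases h : k = i
    · subst h
      simp only [splitAt_X_self, map_X]
    · have : (⟨k, j⟩ : Vars n) = inclVars n i ⟨⟨k, h⟩, j⟩ := rfl
      rw [this]
      simp only [splitAt_X_incl, map_X, map_C]

theorem mem_range_rename_of_splitAt_eq_C {A ι : Type*} [CommRing A] (n : ι → ℕ) (i : ι)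
    {R : MvPolynomial (Vars n) A} {a : MvPolynomial (Vars (del n i)) A}
    (h : splitAt n i R = C a) : R ∈ Set.range (rename (R := A) (inclVars n i)) := by
  refine ⟨a, ?_⟩
  have h1 : (splitEquiv A n i).symm (C a) = rename (inclVars n i) a := aevalTower_C _ _ _
  rw [← h1, ← h]
  exact (splitEquiv A n i).symm_apply_apply R

theorem isSplittable_map {A B : Type*} [CommRing A] [CommRing B] (φ : A →+* B) {n D : ℕ}
    {g : MvPolynomial (Fin (n + 1)) A} (hg : IsSplittable D g) : IsSplittable D (map φ g) := by
  refine ⟨hg.1.map φ, fun hD P hP => ?_⟩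
  have := congrArg φ (hg.2 hD P hP)
  rw [map_zero, map_aeval] at this
  rw [← this, aeval_def, coe_eval₂Hom]
  congr 1
  exact RingHom.ext_int _ _

/-! ### Divisors of constants, of prime powers and of monomials. -/

theorem exists_eq_C_of_dvd_C {σ A : Type*} [CommRing A] [IsDomain A] {p : MvPolynomial σ A} {a : A}
    (ha : a ≠ 0) (h : p ∣ C a) : ∃ b, b ∣ a ∧ p = C b := by
  obtain ⟨q, hq⟩ := h
  have h0 : p * q ≠ 0 := by rw [← hq]; exact C_ne_zero.2 ha
  have hd := congrArg totalDegree hq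
  rw [totalDegree_C, totalDegree_mul_of_isDomain (left_ne_zero_of_mul h0)
    (right_ne_zero_of_mul h0)] at hd
  have hp := totalDegree_eq_zero_iff_eq_C.1 (show p.totalDegree = 0 by omega)
  have hq' := totalDegree_eq_zero_iff_eq_C.1 (show q.totalDegree = 0 by omega)
  refine ⟨coeff 0 p, ⟨coeff 0 q, C_injective σ A ?_⟩, hp⟩
  rw [C_mul, ← hp, ← hq', hq]

/-- A divisor of `r ^ e` is associated to some `r ^ k`; if `k > 0`, then `r` divides a nonzero
constant and is itself constant. -/
theorem isUnit_of_C_dvd_prime_pow {σ A : Type*} [CommRing A] [IsDomain A] {r : MvPolynomial σ A}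
    (hr : Prime r) (hrC : ∀ a, r ≠ C a) {a : A} {e : ℕ} (h : C a ∣ r ^ e) : IsUnit a := by
  have ha : a ≠ 0 := by
    rintro rfl
    rw [C_0, zero_dvd_iff] at h
    exact pow_ne_zero e hr.ne_zero h
  obtain ⟨k, -, hk⟩ := (dvd_prime_pow hr e).1 h
  rcases Nat.eq_zero_or_pos k with rfl | hk0
  · rw [pow_zero, associated_one_iff_isUnit] at hk
    obtain ⟨b, hb, h1⟩ := (isUnit_iff_eq_C_of_isReduced).1 hk
    rwa [C_injective _ _ h1]
  · obtain ⟨b, -, hb⟩ := exists_eq_C_of_dvd_C ha ((dvd_pow_self r hk0.ne').trans hk.dvd')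
    exact absurd hb (hrC b)

/-- Degree and trailing degree are additive and agree on the product, so they agree on `q`, whose
trailing degree is `0`. -/
theorem eq_C_of_mul_eq_X_pow_mul_C {A : Type*} [CommRing A] [IsDomain A] {p q : Polynomial A}
    {D : ℕ} {w : A} (hw : w ≠ 0) (h : p * q = Polynomial.X ^ D * Polynomial.C w)
    (h0 : q.coeff 0 ≠ 0) : q = Polynomial.C (q.coeff 0) := by
  have hne : p * q ≠ 0 := by
    rw [h]; exact mul_ne_zero (pow_ne_zero _ Polynomial.X_ne_zero) (Polynomial.C_ne_zero.2 hw)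
  have hp := left_ne_zero_of_mul hne
  have hq := right_ne_zero_of_mul hne
  have h1 := congrArg Polynomial.natDegree h
  have h2 := congrArg Polynomial.natTrailingDegree h
  rw [Polynomial.natDegree_mul hp hq, mul_comm, Polynomial.natDegree_C_mul_X_pow _ _ hw] at h1
  rw [Polynomial.natTrailingDegree_mul hp hq, mul_comm, Polynomial.C_mul_X_pow_eq_monomial,
    Polynomial.natTrailingDegree_monomial hw] at h2
  have h3 : q.natTrailingDegree = 0 :=
    Nat.eq_zero_of_le_zero (Polynomial.natTrailingDegree_le_of_ne_zero h0)
  have h4 := Polynomial.natTrailingDegree_le_natDegree p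
  exact Polynomial.eq_C_of_natDegree_eq_zero (by omega)

theorem prime_map_C {σ τ A : Type*} [CommRing A] {r : MvPolynomial σ A} (hr : Prime r) :
    Prime (map (C : A →+* MvPolynomial τ A) r) := by
  rw [← commAlgEquiv_C, MulEquiv.prime_iff, prime_C_iff]
  exact hr

/-! ### Specialising the indeterminate form. -/

theorem indetForm_isHomogeneous (A : Type*) [CommRing A] (n d : ℕ) :
    (indetForm A n d).IsHomogeneous d :=
  isHomogeneous_sum_expo _

section specialize
variable {A : Type*} [CommRing A] {V : Type*} {n d : ℕ}

/-- The morphism `A[T][V] → E` extending `A[V] → E` and sending the indeterminate form to `f`. -/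
noncomputable def specialize {E : Type*} [CommRing E] (κ : MvPolynomial V A →+* E)
    (f : MvPolynomial (Fin (n + 1)) E) : MvPolynomial V (MvPolynomial (Expo n d) A) →+* E :=
  eval₂Hom (eval₂Hom (κ.comp C) fun α => coeff α.1 f) fun v => κ (X v)

variable {E : Type*} [CommRing E] (κ : MvPolynomial V A →+* E) (f : MvPolynomial (Fin (n + 1)) E)

theorem specialize_comp_map : (specialize (d := d) κ f).comp
    (map (algebraMap A (MvPolynomial (Expo n d) A))) = κ := by
  ext v
  · simp [specialize, MvPolynomial.algebraMap_eq]
  · simp [specialize]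

theorem specialize_C_X (α : Expo n d) : specialize κ f (C (X α)) = coeff α.1 f := by
  simp [specialize]

theorem map_specialize_indetForm (hf : f.IsHomogeneous d) :
    map (specialize κ f) (map C (indetForm A n d)) = f := by
  refine ext_of_isHomogeneous (((indetForm_isHomogeneous A n d).map _).map _) hf fun α => ?_
  rw [coeff_map, coeff_map, indetForm, coeff_sum_expo, specialize_C_X]

theorem specialize_hom_ext {φ ψ : MvPolynomial V (MvPolynomial (Expo n d) A) →+* E}
    (h : φ.comp (map (algebraMap A (MvPolynomial (Expo n d) A))) =
      ψ.comp (map (algebraMap A (MvPolynomial (Expo n d) A))))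
    (hT : ∀ α : Expo n d, φ (C (X α)) = ψ (C (X α))) : φ = ψ := by
  ext v
  · have := RingHom.congr_fun h (C v)
    simpa [MvPolynomial.algebraMap_eq] using this
  · exact hT v
  · have := RingHom.congr_fun h (X v)
    simpa using this

end specialize

section wedge
variable {A : Type*} [CommRing A] {V : Type*} {n D e : ℕ}
  {r : MvPolynomial (Fin (n + 1)) (MvPolynomial V A)}
  {w : MvPolynomial V (MvPolynomial (Expo n (e + 1)) A)}

theorem IsWedge.specialize_linForm {E : Type*} [CommRing E] [IsDomain E]
    (hw : IsWedge (e + 1) D (map C (indetForm A n (e + 1))) (map (map (algebraMap A _)) r) w)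
    (hr : r.IsHomogeneous D) (hr0 : r ≠ 0) {κ : MvPolynomial V A →+* E} (hκ : Function.Injective κ)
    (z x : Fin (n + 1) → E) : specialize κ (linForm z ^ e * linForm x) w =
      eval z (map κ r) ^ e * eval x (map κ r) := by
  have hg : map (specialize (d := e + 1) κ (linForm z ^ e * linForm x))
      (map (map (algebraMap A _)) r) = map κ r := by
    rw [map_map, specialize_comp_map]
  have h0 : map κ r ≠ 0 := by rwa [ne_eq, map_eq_zero_iff _ (map_injective _ hκ)]
  rw [hw.eq_of_linForm ((indetForm_isHomogeneous A n _).map _) (hr.map _) _ z x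
    (map_specialize_indetForm _ _ ?_) (by rwa [hg]), hg]
  simpa using ((isHomogeneous_linForm z).pow e).mul (isHomogeneous_linForm x)

theorem IsWedge.specialize_C_mul {d : ℕ} {w : MvPolynomial V (MvPolynomial (Expo n d) A)}
    {E : Type*} [CommRing E] [IsDomain E]
    (hw : IsWedge d D (map C (indetForm A n d)) (map (map (algebraMap A _)) r) w)
    (hr : r.IsHomogeneous D) (hr0 : r ≠ 0) {φ : MvPolynomial V (MvPolynomial (Expo n d) A) →+* E}
    (hφ : Function.Injective φ) (a : E) :
    specialize (φ.comp (map (algebraMap A _))) (C a * map φ (map C (indetForm A n d))) w =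
      a ^ D * φ w := by
  have hinj : Function.Injective (φ.comp (map (algebraMap A (MvPolynomial (Expo n d) A)))) :=
    hφ.comp (map_injective _ (C_injective _ _))
  refine hw.eq_pow_mul ((indetForm_isHomogeneous A n _).map _) (hr.map _) φ _
    (map_specialize_indetForm _ _ (((indetForm_isHomogeneous A n _).map _).map _ |>.C_mul _)) ?_ ?_
  · rw [map_map, specialize_comp_map, map_map]
  · rwa [map_map, ne_eq, map_eq_zero_iff _ (map_injective _ hinj)]

/-- The morphism `A[T][V] → A[V]` killing `T`. -/
noncomputable def killIndet (A : Type*) [CommRing A] (V : Type*) (n d : ℕ) :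
    MvPolynomial V (MvPolynomial (Expo n d) A) →+* MvPolynomial V A :=
  specialize (RingHom.id _) (0 : MvPolynomial (Fin (n + 1)) (MvPolynomial V A))

theorem killIndet_comp_map (A : Type*) [CommRing A] (V : Type*) (n d : ℕ) :
    (killIndet A V n d).comp (map (algebraMap A _)) = RingHom.id _ :=
  specialize_comp_map _ _

theorem killIndet_C_X (A : Type*) [CommRing A] (V : Type*) (n d : ℕ) (α : Expo n d) :
    killIndet A V n d (C (X α)) = 0 :=
  (specialize_C_X _ _ α).trans (coeff_zero _)

/-- The factor `linForm x` vanishes under `ε`, so `ε ∘ ψ` sends every `T_α` to `0`. -/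
theorem IsWedge.exists_specialization_of_section {S₁ S₂ : Type*} [CommRing S₁] [CommRing S₂]
    [IsDomain S₂]
    (hw : IsWedge (e + 1) D (map C (indetForm A n (e + 1))) (map (map (algebraMap A _)) r) w)
    (hr : r.IsHomogeneous D) (hr0 : r ≠ 0) {c₁ : MvPolynomial V A →+* S₁} {c₂ : S₁ →+* S₂}
    (h₁ : Function.Injective c₁) (h₂ : Function.Injective c₂) {ε : S₂ →+* S₁}
    (hε : ∀ s, ε (c₂ s) = s) (z : Fin (n + 1) → S₁) {x : Fin (n + 1) → S₂} (hx : ∀ j, ε (x j) = 0) :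
    ∃ ψ : MvPolynomial V (MvPolynomial (Expo n (e + 1)) A) →+* S₂,
      ψ w = c₂ (eval z (map c₁ r)) ^ e * eval x (map (c₂.comp c₁) r) ∧
      ∀ p, ε (ψ p) = c₁ (killIndet A V n _ p) := by
  refine ⟨specialize (c₂.comp c₁) (linForm (c₂ ∘ z) ^ e * linForm x), ?_, fun p => ?_⟩
  · rw [hw.specialize_linForm hr hr0 (h₂.comp h₁), map_eval, map_map]
  · have h : ε.comp (specialize (d := e + 1) (c₂.comp c₁) (linForm (c₂ ∘ z) ^ e * linForm x)) =
        c₁.comp (killIndet A V n (e + 1)) := by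
      refine specialize_hom_ext ?_ fun α => ?_
      · rw [RingHom.comp_assoc, RingHom.comp_assoc, specialize_comp_map, killIndet_comp_map]
        exact RingHom.ext fun s => hε _
      · rw [RingHom.comp_apply, RingHom.comp_apply, specialize_C_X, killIndet_C_X, ← coeff_map,
          map_mul, map_linForm, show ε ∘ x = 0 from funext hx, linForm_zero, mul_zero, coeff_zero,
          map_zero]
    exact RingHom.congr_fun h p

/-- Specializing the indeterminate form to `(X · Z) ^ e (X · X')`. -/
theorem IsWedge.exists_specialization [IsDomain A]
    (hw : IsWedge (e + 1) D (map C (indetForm A n (e + 1))) (map (map (algebraMap A _)) r) w)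
    (hr : r.IsHomogeneous D) (hr0 : r ≠ 0) :
    ∃ ψ : MvPolynomial V (MvPolynomial (Expo n (e + 1)) A) →+*
        MvPolynomial (Fin (n + 1)) (MvPolynomial (Fin (n + 1)) (MvPolynomial V A)),
      ψ w = C r ^ e * map C r ∧ ∀ p, constantCoeff (ψ p) = C (killIndet A V n _ p) := by
  let S₁ := MvPolynomial (Fin (n + 1)) (MvPolynomial V A)
  obtain ⟨ψ, hψ, hε⟩ := hw.exists_specialization_of_section hr hr0 (S₁ := S₁)
    (S₂ := MvPolynomial (Fin (n + 1)) S₁) (c₁ := C) (c₂ := C) (ε := constantCoeff)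
    (C_injective _ _) (C_injective _ _) (fun s => constantCoeff_C _ s) X (x := X)
    (fun j => constantCoeff_X _ j)
  refine ⟨ψ, hψ.trans (congrArg₂ (fun a b => C a ^ e * b) ?_ ?_), hε⟩
  · rw [eval_map]
    exact eval₂_eta r
  · rw [← map_map, eval_map]
    exact eval₂_eta _

/-- Where `a` becomes `0` the scaled form vanishes, and where `a` becomes `1` it is the
indeterminate form again. -/
theorem IsWedge.exists_scaling_of_section {d : ℕ}
    {w : MvPolynomial V (MvPolynomial (Expo n d) A)} {E : Type*} [CommRing E] [IsDomain E]
    (hw : IsWedge d D (map C (indetForm A n d)) (map (map (algebraMap A _)) r) w)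
    (hr : r.IsHomogeneous D) (hr0 : r ≠ 0)
    {c : MvPolynomial V (MvPolynomial (Expo n d) A) →+* E} {a : E}
    {ε₀ ε₁ : E →+* MvPolynomial V (MvPolynomial (Expo n d) A)}
    (h₀ : ∀ s, ε₀ (c s) = s) (h₁ : ∀ s, ε₁ (c s) = s) (ha₀ : ε₀ a = 0) (ha₁ : ε₁ a = 1) :
    ∃ ρ : MvPolynomial V (MvPolynomial (Expo n d) A) →+* E, ρ w = a ^ D * c w ∧
      (∀ p, ε₀ (ρ p) = map (algebraMap A _) (killIndet A V n d p)) ∧ ∀ p, ε₁ (ρ p) = p := by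
  have hcoeff : ∀ α : Expo n d, coeff α.1 (C a * map c (map C (indetForm A n d))) =
      a * c (C (X α)) := fun α => by
    rw [coeff_C_mul, coeff_map, coeff_map, indetForm, coeff_sum_expo]
  refine ⟨_, hw.specialize_C_mul hr hr0 (Function.LeftInverse.injective h₀) a,
    fun p => ?_, fun p => ?_⟩
  · have h : ε₀.comp (specialize (c.comp (map (algebraMap A _)))
        (C a * map c (map C (indetForm A n d)))) =
        (map (algebraMap A _)).comp (killIndet A V n d) := by
      refine specialize_hom_ext ?_ fun α => ?_
      · rw [RingHom.comp_assoc, RingHom.comp_assoc, specialize_comp_map, killIndet_comp_map]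
        exact RingHom.ext fun s => h₀ _
      · rw [RingHom.comp_apply, RingHom.comp_apply, specialize_C_X, killIndet_C_X, hcoeff,
          map_zero, map_mul, ha₀, zero_mul]
    exact RingHom.congr_fun h p
  · have h : ε₁.comp (specialize (c.comp (map (algebraMap A _)))
        (C a * map c (map C (indetForm A n d)))) = RingHom.id _ := by
      refine specialize_hom_ext ?_ fun α => ?_
      · rw [RingHom.comp_assoc, specialize_comp_map]
        exact RingHom.ext fun s => h₁ _
      · rw [RingHom.comp_apply, specialize_C_X, hcoeff, map_mul, ha₁, one_mul, h₁,
          RingHom.id_apply]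
    exact RingHom.congr_fun h p

/-- Multiplying the indeterminate form by a scalar. -/
theorem IsWedge.exists_scaling [IsDomain A] {d : ℕ} {w : MvPolynomial V (MvPolynomial (Expo n d) A)}
    (hw : IsWedge d D (map C (indetForm A n d)) (map (map (algebraMap A _)) r) w)
    (hr : r.IsHomogeneous D) (hr0 : r ≠ 0) :
    ∃ ρ : MvPolynomial V (MvPolynomial (Expo n d) A) →+*
        Polynomial (MvPolynomial V (MvPolynomial (Expo n d) A)),
      ρ w = Polynomial.X ^ D * Polynomial.C w ∧
      (∀ p, (ρ p).coeff 0 = map (algebraMap A _) (killIndet A V n d p)) ∧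
      ∀ p, (ρ p).eval 1 = p := by
  let B := MvPolynomial V (MvPolynomial (Expo n d) A)
  obtain ⟨ρ, hρ, hρ₀, hρ₁⟩ := hw.exists_scaling_of_section hr hr0 (E := Polynomial B)
    (c := Polynomial.C) (a := Polynomial.X) (ε₀ := Polynomial.constantCoeff)
    (ε₁ := Polynomial.evalRingHom 1) (fun _ => Polynomial.coeff_C_zero)
    (fun _ => Polynomial.eval_C) Polynomial.coeff_X_zero Polynomial.eval_X
  exact ⟨ρ, hρ, hρ₀, hρ₁⟩

/-! ### Irreducibility. -/

theorem irreducible_of_isWedge_indetForm [IsDomain A] (hr : r.IsHomogeneous D) (hrp : Prime r)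
    (hrC : ∀ a, r ≠ C a)
    (hw : IsWedge (e + 1) D (map C (indetForm A n (e + 1))) (map (map (algebraMap A _)) r) w) :
    Irreducible w := by
  obtain ⟨ψ, hψ, hε⟩ := hw.exists_specialization hr hrp.ne_zero
  obtain ⟨ρ, hρ, hρ0, hρ1⟩ := hw.exists_scaling hr hrp.ne_zero
  have hrp' : Prime (map (C : _ →+* MvPolynomial (Fin (n + 1)) (MvPolynomial V A)) r) :=
    prime_map_C hrp
  have hw0 : w ≠ 0 := by
    rintro rfl
    rw [map_zero] at hψ
    exact mul_ne_zero (pow_ne_zero _ (C_ne_zero.2 hrp.ne_zero)) hrp'.ne_zero hψ.symm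
  have key : ∀ p q, w = p * q → map C r ∣ ψ p → IsUnit q := by
    rintro p q hpq ⟨u, hu⟩
    rw [hpq, map_mul, hu, mul_assoc, mul_comm (C r ^ e)] at hψ
    have hdvd : ψ q ∣ C (r ^ e) := by
      rw [C_pow, ← mul_left_cancel₀ hrp'.ne_zero hψ]
      exact Dvd.intro_left _ rfl
    obtain ⟨b, hb, hqb⟩ := exists_eq_C_of_dvd_C (pow_ne_zero e hrp.ne_zero) hdvd
    -- As `ψ q` is free of `X'`, it equals its value at `X' = 0`, where all `T_α` are killed.
    have hbθ : b = C (killIndet A V n _ q) := by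
      rw [← hε, hqb, constantCoeff_C]
    have hκ0 : map (algebraMap A (MvPolynomial (Expo n (e + 1)) A)) (killIndet A V n _ q) ≠ 0 := by
      have hinj : Function.Injective (algebraMap A (MvPolynomial (Expo n (e + 1)) A)) :=
        C_injective _ _
      rw [ne_eq, map_eq_zero_iff _ (map_injective _ hinj)]
      rintro h
      rw [h, C_0] at hbθ
      exact ne_zero_of_dvd_ne_zero (pow_ne_zero e hrp.ne_zero) hb hbθ
    -- Since `ρ q` divides `y ^ D w` and is nonzero at `y = 0`, it is constant in `y`; its values at
    -- `0` and `1` identify `q` with its specialisation at `T = 0`.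
    have hq := eq_C_of_mul_eq_X_pow_mul_C hw0 (by rw [← map_mul, ← hpq, hρ]) (hρ0 q ▸ hκ0)
    have hq1 := hρ1 q
    rw [hq, Polynomial.eval_C, hρ0] at hq1
    rw [← hq1]
    exact (isUnit_of_C_dvd_prime_pow hrp hrC (hbθ ▸ hb)).map _
  have hdvd := Dvd.intro_left _ hψ.symm
  refine ⟨fun hu => hrp'.not_isUnit (isUnit_of_dvd_unit hdvd (hu.map _)), fun p q hpq => ?_⟩
  rw [hpq, map_mul] at hdvd
  rcases hrp'.dvd_or_dvd hdvd with h | h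
  · exact Or.inr (key p q hpq h)
  · exact Or.inl (key q p (hpq.trans (mul_comm _ _)) h)

end wedge

end ResultantWedge

theorem mainTheorem9 {A : Type*} [CommRing A] [IsDomain A] [UniqueFactorizationMonoid A]
    {ι : Type*} [Finite ι] (n : ι → ℕ) (i : ι) (D : ι → ℕ)
    (R : MvPolynomial (ResultantWedge.Vars n) A)
    (hR : ResultantWedge.IsResultant n D R) (hirr : Irreducible R)
    (hi : R ∉ Set.range (MvPolynomial.rename (R := A) (ResultantWedge.inclVars n i)))
    (d : ℕ) (hd : 1 ≤ d) :
    Irreducible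
      (ResultantWedge.wedgeAt n i d (D i) (ResultantWedge.indetForm A (n i) d)
        (MvPolynomial.map (algebraMap A (MvPolynomial (ResultantWedge.Expo (n i) d) A)) R)) := by
  open ResultantWedge in
  -- Positivity of `d` provides the one factor `X · X'` besides `(X · Z) ^ e`.
  obtain ⟨e, rfl⟩ := Nat.exists_eq_add_of_le' hd
  have hs : IsSplittable (D i) (splitAt n i R) := by
    cases hR with
    | intro _ _ _ h _ _ => exact h i
  have hrp : Prime (splitAt n i R) := by
    rw [← UniqueFactorizationMonoid.irreducible_iff_prime]
    exact (MulEquiv.irreducible_iff (splitEquiv A n i)).2 hirr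
  have hrC : ∀ a, splitAt n i R ≠ C a := fun a ha => hi (mem_range_rename_of_splitAt_eq_C n i ha)
  have hD : 0 < D i := by
    rw [Nat.pos_iff_ne_zero]
    intro h0
    exact hrC _ (totalDegree_eq_zero_iff_eq_C.1 ((hs.1.totalDegree hrp.ne_zero).trans h0))
  have hex : ∃ w, IsWedge (e + 1) (D i) (map C (indetForm A (n i) (e + 1)))
      (splitAt n i (map (algebraMap A (MvPolynomial (Expo (n i) (e + 1)) A)) R)) w := by
    rw [splitAt_map]
    -- The coefficient ring is a polynomial ring over a factorial domain, hence factorial and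
    -- integrally closed.
    refine exists_isWedge hD ((indetForm_isHomogeneous A _ _).map _) (isSplittable_map _ hs) ?_
    have hinj : Function.Injective (algebraMap A (MvPolynomial (Expo (n i) (e + 1)) A)) :=
      C_injective _ _
    rw [ne_eq, map_eq_zero_iff _ (map_injective _ (map_injective _ hinj))]
    exact hrp.ne_zero
  rw [wedgeAt, wedge, dif_pos hex]
  refine irreducible_of_isWedge_indetForm hs.1 hrp hrC ?_
  rw [← splitAt_map]
  exact hex.choose_spec
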